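/- Let $n\ge 1$ and $0<a_1<\dots<a_{n+1}$, set $a_0=0$, and let $Q=\{x\in\mathbb{R}^{n+1}:\sum_i x_i^2/a_i=1\}$. For $\mu\in\mathbb{R}\setminus\{a_1,\dots,a_{n+1}\}$ put $Q_\mu=\{x:\sum_i x_i^2/(a_i-\mu)=1\}$, and put $Q_{a_j}=\{x:x_j=0\}$. For $\sigma\in\{0,1\}^n$ let $$\Lambda_\sigma=\{\lambda\in\mathbb{R}^n:\ 0<\lambda_1<\dots<\lambda_n,\ \lambda_i\in(a_{i+\sigma_i-1},a_{i+\sigma_i})\text{ for }1\le i\le n\}.$$ A billiard trajectory inside $Q$ has caustic parameter $\lambda\in\Lambda_\sigma$ (is of type $\sigma$) if all its lines are tangent, possibly at infinity, to $Q_{\lambda_1},\dots,Q_{\lambda_n}$. Its period is the least number of bounces after which it closes. Let $0=c_0<c_1<\dots<c_{2n+1}$ be the elements of $\{0,a_1,\dots,a_{n+1},\lambda_1,\dots,\lambda_n\}$ in increasing order. The winding numbers of a periodic trajectory with caustic parameter $\lambda\in\Lambda_\sigma$ are the integers $m_0,\dots,m_n$ such that $m_0$ is its period and, for $0\le j\le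 n$, it has along one period exactly $m_j$ points at $Q_{c_{2j}}$ and exactly $m_j$ points at $Q_{c_{2j+1}}$, counted with respect to time. Let $E_\sigma\subseteq\{0,\dots,n\}$ be defined by: $0\in E_\sigma\Leftrightarrow\sigma_1=1$; for $1\le j\le n-1$, $j\in E_\sigma\Leftrightarrow(\sigma_j,\sigma_{j+1})\ne(1,0)$; and $n\in E_\sigma$. Finally let $$\varkappa(\sigma)=\min\{m_0:\ \text{there are integers } 2\le m_n<\dots<m_1<m_0\text{ with } m_j\text{ even for all } j\in E_\sigma\}.$$ **Theorem.** 1. Every periodic trajectory with caustic parameter in $\Lambda_\sigma$ has winding numbers $m_0,\dots,m_n$, and $m_j$ is even for all $j\in E_\sigma$. 2. Assume the conjecture that for all ellipsoids of $\mathbb{R}^{n+1}$ as above, and for all $\sigma$, the winding numbers of every periodic trajectory of type $\sigma$ satisfy $2\le m_n<\dots<m_1<m_0$. Then, for each $\sigma\in\{0,1\}^n$, every periodic trajectory inside such an ellipsoid with caustic parameter in $\Lambda_\sigma$ has period at least $\varkappa(\sigma)$. 3. Let $\mathbf 1=(1,\dots,1)$ and $\varsigma=(\dots,0,1,0,1,0)$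 in $\{0,1\}^n$ (alternating, with last entry $0$). Then $\varkappa(\varsigma)=n+2$, $\varkappa(\mathbf 1)=2n+2$, and $\varkappa(\varsigma)<\varkappa(\sigma)<\varkappa(\mathbf 1)$ for all $\sigma\ne\mathbf 1,\varsigma$. 4. Let $n=2$ and assume the conjecture of item 2 for $n=2$. A periodic trajectory inside a triaxial ellipsoid $0<a_1<a_2<a_3$ of $\mathbb{R}^3$ with caustics $Q_{\lambda_1},Q_{\lambda_2}$, $\lambda_1<\lambda_2$, has period at least $5$, $4$, $5$, $6$ if its type is, respectively: EH1 ($\lambda_1\in(0,a_1)$, $\lambda_2\in(a_1,a_2)$), H1H1 ($\lambda_1,\lambda_2\in(a_1,a_2)$), EH2 ($\lambda_1\in(0,a_1)$, $\lambda_2\in(a_2,a_3)$), H1H2 ($\lambda_1\in(a_1,a_2)$, $\lambda_2\in(a_2,a_3)$). -/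

import Mathlib

/-!
Billiards inside the ellipsoid `∑ i, x i ^ 2 / a i = 1` of `ℝ^(n+1)`, with `0 < a 0 < ⋯ < a n`.
Indices of semi-axes, caustics and signs start at `0`, so `a i`, `l i`, `σ i` stand for the usual
`a_{i+1}`, `λ_{i+1}`, `σ_{i+1}`.
-/

namespace EllipsoidBilliard

noncomputable section

/-- Squared semi-axes of a nondegenerate ellipsoid: positive and pairwise distinct, in order. -/
def NondegenerateAxes {n : ℕ} (a : Fin (n + 1) → ℝ) : Prop :=
  0 < a 0 ∧ StrictMono a

/-- The confocal quadric `Q_μ`; for `μ = a j` it is the coordinate hyperplane `x j = 0`.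
The ellipsoid itself is the quadric with `μ = 0`. -/
def confocalQuadric {n : ℕ} (a : Fin (n + 1) → ℝ) (μ : ℝ) :
    Set (EuclideanSpace ℝ (Fin (n + 1))) :=
  {x | (∃ j, a j = μ ∧ x j = 0) ∨ (μ ∉ Set.range a ∧ ∑ i, x i ^ 2 / (a i - μ) = 1)}

/-- The outward normal vector `(x i / a i)` to the ellipsoid at the point `x` of it. -/
def normalVector {n : ℕ} (a : Fin (n + 1) → ℝ) (x : EuclideanSpace ℝ (Fin (n + 1))) :
    EuclideanSpace ℝ (Fin (n + 1)) :=
  WithLp.toLp 2 (fun i => x i / a i)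

/-- The reflection `p = p_t + p_n ↦ p_t - p_n = p - 2 p_n` in the hyperplane tangent to the
ellipsoid at `x`. -/
def reflectAt {n : ℕ} (a : Fin (n + 1) → ℝ) (x p : EuclideanSpace ℝ (Fin (n + 1))) :
    EuclideanSpace ℝ (Fin (n + 1)) :=
  p - (2 * (inner ℝ (normalVector a x) p / inner ℝ (normalVector a x) (normalVector a x))) •
    normalVector a x

/-- A billiard trajectory inside the ellipsoid: a bi-infinite orbit `(q k, p k)` of the billiard map
on the pairs (impact point, outward unit velocity with which the particle arrives there). -/
structure Trajectory {n : ℕ} (a : Fin (n + 1) → ℝ) where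
  /-- impact points -/
  q : ℤ → EuclideanSpace ℝ (Fin (n + 1))
  /-- arrival velocities -/
  p : ℤ → EuclideanSpace ℝ (Fin (n + 1))
  q_mem : ∀ k, q k ∈ confocalQuadric a 0
  norm_p : ∀ k, ‖p k‖ = 1
  outward : ∀ k, 0 < inner ℝ (normalVector a (q k)) (p k)
  p_step : ∀ k, p (k + 1) = reflectAt a (q k) (p k)
  q_step : ∀ k, ∃ t : ℝ, 0 < t ∧ q (k + 1) = q k + t • p (k + 1)

/-- The line `x + ℝ v` is tangent to the nonsingular confocal quadric `Q_μ`: the quadratic polynomial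
`t ↦ ∑ i, (x i + t v i) ^ 2 / (a i - μ) - 1` has discriminant zero. As usual in this setting,
the point of tangency may lie at infinity. (A line contained in `Q_μ` also satisfies this, but it is
never tangent to `n` distinct nonsingular confocal quadrics.) -/
def TangentTo {n : ℕ} (a : Fin (n + 1) → ℝ) (μ : ℝ) (x v : EuclideanSpace ℝ (Fin (n + 1))) : Prop :=
  discrim (∑ i, v i ^ 2 / (a i - μ)) (2 * ∑ i, x i * v i / (a i - μ))
    (∑ i, x i ^ 2 / (a i - μ) - 1) = 0

/-- All the lines of the trajectory are tangent to the quadrics with parameters `l 0, …, l (n-1)`. -/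
def Trajectory.HasCaustics {n : ℕ} {a : Fin (n + 1) → ℝ} (γ : Trajectory a) (l : Fin n → ℝ) : Prop :=
  ∀ k i, TangentTo a (l i) (γ.q k) (γ.p (k + 1))

/-- The trajectory is periodic and its (least) period is `m` bounces. -/
def Trajectory.HasPeriod {n : ℕ} {a : Fin (n + 1) → ℝ} (γ : Trajectory a) (m : ℕ) : Prop :=
  IsLeast {k : ℕ | 0 < k ∧ ∀ i : ℤ, γ.q (i + k) = γ.q i} m

/-- The semi-axes parameters preceded by `0`, that is, `0, a 0, …, a n`. -/
def axes₀ {n : ℕ} (a : Fin (n + 1) → ℝ) : Fin (n + 2) → ℝ :=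
  Fin.cons 0 a

/-- The nonsingular caustic space. -/
def causticSpace {n : ℕ} (a : Fin (n + 1) → ℝ) : Set (Fin n → ℝ) :=
  {l | (∀ i, 0 < l i) ∧ StrictMono l ∧
    ∀ i : Fin n, l i ∈ Set.Ioo (axes₀ a i.castSucc.castSucc) (axes₀ a i.succ.castSucc) ∪
      Set.Ioo (axes₀ a i.succ.castSucc) (axes₀ a i.succ.succ)}

/-- The component of the nonsingular caustic space of caustic type `σ`: with indices starting at `1`
and `a_0 = 0`, the condition reads `λ_i ∈ (a_{i + σ_i - 1}, a_{i + σ_i})`. -/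
def causticComponent {n : ℕ} (a : Fin (n + 1) → ℝ) (σ : Fin n → Fin 2) : Set (Fin n → ℝ) :=
  {l | (∀ i, 0 < l i) ∧ StrictMono l ∧
    ∀ i : Fin n, l i ∈ Set.Ioo (axes₀ a ⟨i + σ i, by omega⟩) (axes₀ a ⟨i + σ i + 1, by omega⟩)}

/-- `0 = c 0 < c 1 < ⋯ < c (2n+1)` is the ordered list of `0`, the `a i` and the `l i`. -/
def IsOrderedList {n : ℕ} (a : Fin (n + 1) → ℝ) (l : Fin n → ℝ) (c : Fin (2 * n + 2) → ℝ) : Prop :=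
  c 0 = 0 ∧ StrictMono c ∧
    Set.range (fun i : Fin (2 * n + 1) => c i.succ) = Set.range a ∪ Set.range l

/-- The instants, during `m` consecutive bounces, at which the trajectory is at the quadric `Q_μ`.
The pair `(k, t)` with `0 ≤ t < 1` stands for the point that divides the segment from `q k` to
`q (k + 1)` in the ratio `t : 1 - t`. When `μ` is a caustic parameter of a nonsingular trajectory,
these are its tangential touches with `Q_μ`; when `μ = a j`, its crossings with `x j = 0`. -/
def Trajectory.visits {n : ℕ} {a : Fin (n + 1) → ℝ} (γ : Trajectory a) (m : ℕ) (μ : ℝ) :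
    Set (ℕ × ℝ) :=
  {s | s.1 < m ∧ s.2 ∈ Set.Ico (0 : ℝ) 1 ∧
    AffineMap.lineMap (γ.q s.1) (γ.q (s.1 + 1)) s.2 ∈ confocalQuadric a μ}

/-- `m 0, …, m n` are the winding numbers of the trajectory `γ` with caustic parameters `l`: `m 0` is
the period and, along one period, there are exactly `m j` points at `Q_{c (2j)}` and exactly `m j`
points at `Q_{c (2j+1)}`. -/
def Trajectory.HasWindingNumbers {n : ℕ} {a : Fin (n + 1) → ℝ} (γ : Trajectory a) (l : Fin n → ℝ)
    (m : Fin (n + 1) → ℕ) : Prop :=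
  γ.HasPeriod (m 0) ∧ ∃ c : Fin (2 * n + 2) → ℝ, IsOrderedList a l c ∧
    ∀ j : Fin (n + 1),
      (γ.visits (m 0) (c ⟨2 * j, by omega⟩)).encard = m j ∧
      (γ.visits (m 0) (c ⟨2 * j + 1, by omega⟩)).encard = m j

/-- The conjecture, for ellipsoids of `ℝ^(n+1)`, that the winding numbers of every nonsingular
periodic billiard trajectory satisfy `2 ≤ m n < ⋯ < m 1 < m 0`. -/
def WindingNumbersConjecture (n : ℕ) : Prop :=
  ∀ a : Fin (n + 1) → ℝ, NondegenerateAxes a → ∀ l ∈ causticSpace a, ∀ γ : Trajectory a,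
    γ.HasCaustics l → ∀ m : Fin (n + 1) → ℕ, γ.HasWindingNumbers l m →
      2 ≤ m (Fin.last n) ∧ StrictAnti m

/-- The set `E_σ ⊆ {0, …, n}`, for `n ≥ 1`. With `σ_1, …, σ_n` the entries of `σ`: it contains `0` iff
`σ_1 = 1`; it contains `j` with `0 < j < n` iff `(σ_j, σ_{j+1}) ≠ (1, 0)`; it contains `n`. -/
def evenIndices {n : ℕ} (σ : Fin n → Fin 2) : Set (Fin (n + 1)) :=
  {j | (∃ i : Fin n, (j : ℕ) = 0 ∧ (i : ℕ) = 0 ∧ σ i = 1) ∨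
    (∃ i i' : Fin n, (i : ℕ) + 1 = j ∧ (i' : ℕ) = j ∧ (σ i, σ i') ≠ (1, 0)) ∨
    (j : ℕ) = n}

/-- The possible first terms of sequences `2 ≤ m n < ⋯ < m 0` with `m j` even for `j ∈ E_σ`. -/
def admissiblePeriods {n : ℕ} (σ : Fin n → Fin 2) : Set ℕ :=
  {k | ∃ m : Fin (n + 1) → ℕ, m 0 = k ∧ 2 ≤ m (Fin.last n) ∧ StrictAnti m ∧
    ∀ j ∈ evenIndices σ, Even (m j)}

/-- `κ(σ)`, the minimum of the (nonempty) set of admissible periods. -/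
def kappa {n : ℕ} (σ : Fin n → Fin 2) : ℕ :=
  sInf (admissiblePeriods σ)

theorem admissiblePeriods_nonempty {n : ℕ} (σ : Fin n → Fin 2) : (admissiblePeriods σ).Nonempty := by
  refine ⟨_, fun j => 2 * (n + 1 - j), rfl, ?_, ?_, ?_⟩
  · simp
  · intro i j hij
    have := j.isLt
    have : (i : ℕ) < j := hij
    simp only
    omega
  · intro j _
    exact even_two_mul _

theorem kappa_isLeast {n : ℕ} (σ : Fin n → Fin 2) : IsLeast (admissiblePeriods σ) (kappa σ) :=
  ⟨Nat.sInf_mem (admissiblePeriods_nonempty σ), fun _ hk => Nat.sInf_le hk⟩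

/-- The alternating vector `ς = (…, 0, 1, 0, 1, 0)`, whose last entry is `0`. -/
def alternating (n : ℕ) : Fin n → Fin 2 :=
  fun i => if Even (n - 1 - (i : ℕ)) then 0 else 1

end

end EllipsoidBilliard

/-! Let `D(z) = ∏ (z - a k)`. For a point `x` the monic polynomial `P = confocalPoly a x` has as
roots the parameters of the confocal quadrics through `x`, coordinate hyperplanes included: its
elliptic coordinates. Along a line `x + t v` it becomes `P + 2 t W + t² V`, with `W = bilinPoly a x
v` and `V = bilinPoly a v v`. The polynomial `V P - W²` is monic of degree `2n + 1`; it vanishes at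
each `a i` identically and at each `l i` by tangency, so it equals `∏ (z - a i) ∏ (z - l i)`
(`CausticIdentity`). The dynamics is read off the signs of this product.

In a gap `(c (2j+1), c (2j+2))` the product is positive, so `P` has no zero and a known sign there.
Hence `P` has exactly one root `μ j` in each `[c (2j), c (2j+1)]` (`exists_elliptic_coordinates`).
Inside such an interval the product is negative, so `W ≠ 0` wherever `P = 0`: the trajectory crosses
the quadric transversally, even at a bounce, because the reflection preserves `W`
(`bilinPoly_reflectAt`). So `μ j` has no local extremum strictly between its ends, and a Rolle
argument shows that along a period it visits both ends equally often (`encard_path_ends`). The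
common count is the winding number `m j`; for `j = 0` the lower end is the ellipsoid and the count
is the number of bounces.

If `j ∈ E_σ`, one of the two ends is some `a i` (`end_mem_range_axes`). Its visits are the sign
changes of the coordinate `i` along a closed polygon, hence even in number. The lower bound on the
period then follows from the conjecture and the definition of `kappa`; its values come from
elementary estimates of decreasing integer sequences. -/

namespace EllipsoidBilliard

/-! ### Polynomials attached to a point and to a line. -/

open Polynomial

noncomputable section

/-- The product of the `z - a k` for `k ≠ i`. -/
def cofactor {n : ℕ} (a : Fin (n + 1) → ℝ) (i : Fin (n + 1)) : ℝ[X] :=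
  ∏ k ∈ Finset.univ.erase i, (X - C (a k))

/-- The product of the `z - a k`. -/
def axesPoly {n : ℕ} (a : Fin (n + 1) → ℝ) : ℝ[X] :=
  ∏ k, (X - C (a k))

/-- `∑ i, x i * y i / (z - a i)`, multiplied by the product of the `z - a k`. -/
def bilinPoly {n : ℕ} (a : Fin (n + 1) → ℝ) (x y : EuclideanSpace ℝ (Fin (n + 1))) : ℝ[X] :=
  ∑ i, C (x i * y i) * cofactor a i

/-- `1 - ∑ i, x i ^ 2 / (a i - z)`, multiplied by the product of the `z - a k`: the monic polynomial
whose roots are the elliptic coordinates of `x`. -/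
def confocalPoly {n : ℕ} (a : Fin (n + 1) → ℝ) (x : EuclideanSpace ℝ (Fin (n + 1))) : ℝ[X] :=
  axesPoly a + bilinPoly a x x

section Polynomials

variable {n : ℕ} {a : Fin (n + 1) → ℝ} {x y v : EuclideanSpace ℝ (Fin (n + 1))}

theorem mul_cofactor (i : Fin (n + 1)) : (X - C (a i)) * cofactor a i = axesPoly a :=
  Finset.mul_prod_erase _ (fun k => X - C (a k)) (Finset.mem_univ i)

theorem monic_cofactor (i : Fin (n + 1)) : (cofactor a i).Monic :=
  monic_prod_of_monic _ _ fun k _ => monic_X_sub_C (a k)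

theorem natDegree_cofactor (i : Fin (n + 1)) : (cofactor a i).natDegree = n := by
  rw [cofactor, natDegree_prod_of_monic _ _ fun k _ => monic_X_sub_C (a k)]
  simp

theorem monic_axesPoly : (axesPoly a).Monic :=
  monic_prod_of_monic _ _ fun k _ => monic_X_sub_C (a k)

theorem natDegree_axesPoly : (axesPoly a).natDegree = n + 1 := by
  rw [axesPoly, natDegree_prod_of_monic _ _ fun k _ => monic_X_sub_C (a k)]
  simp

theorem natDegree_bilinPoly_le : (bilinPoly a x y).natDegree ≤ n :=
  natDegree_sum_le_of_forall_le _ _ fun i _ =>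
    (natDegree_C_mul_le _ _).trans (natDegree_cofactor i).le

theorem coeff_bilinPoly : (bilinPoly a x y).coeff n = ∑ i, x i * y i := by
  rw [bilinPoly, finsetSum_coeff]
  refine Finset.sum_congr rfl fun i _ => ?_
  have h := (monic_cofactor (a := a) i).coeff_natDegree
  rw [natDegree_cofactor] at h
  rw [coeff_C_mul, h, mul_one]

theorem degree_bilinPoly_lt : (bilinPoly a x y).degree < (axesPoly a).degree := by
  rw [degree_eq_natDegree monic_axesPoly.ne_zero, natDegree_axesPoly]
  exact degree_le_natDegree.trans_lt
    (by exact_mod_cast Nat.lt_succ_of_le natDegree_bilinPoly_le)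

theorem monic_confocalPoly : (confocalPoly a x).Monic :=
  monic_axesPoly.add_of_left degree_bilinPoly_lt

theorem natDegree_confocalPoly : (confocalPoly a x).natDegree = n + 1 := by
  rw [confocalPoly, natDegree_eq_of_degree_eq (degree_add_eq_left_of_degree_lt degree_bilinPoly_lt),
    natDegree_axesPoly]

theorem eval_axesPoly (z : ℝ) : (axesPoly a).eval z = ∏ k, (z - a k) := by
  simp [axesPoly, eval_prod]

theorem eval_cofactor (i : Fin (n + 1)) (z : ℝ) :
    (cofactor a i).eval z = ∏ k ∈ Finset.univ.erase i, (z - a k) := by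
  simp [cofactor, eval_prod]

theorem eval_axesPoly_axis (i : Fin (n + 1)) : (axesPoly a).eval (a i) = 0 := by
  rw [← mul_cofactor i]
  simp

theorem eval_cofactor_ne {i k : Fin (n + 1)} (h : k ≠ i) : (cofactor a k).eval (a i) = 0 := by
  rw [eval_cofactor]
  exact Finset.prod_eq_zero (Finset.mem_erase.2 ⟨h.symm, Finset.mem_univ i⟩) (sub_self _)

theorem eval_bilinPoly (z : ℝ) :
    (bilinPoly a x y).eval z = ∑ i, x i * y i * (cofactor a i).eval z := by
  simp [bilinPoly, eval_finsetSum]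

theorem eval_bilinPoly_axis (i : Fin (n + 1)) :
    (bilinPoly a x y).eval (a i) = x i * y i * (cofactor a i).eval (a i) := by
  rw [eval_bilinPoly]
  refine Finset.sum_eq_single i (fun k _ hk => ?_) (by simp)
  rw [eval_cofactor_ne hk, mul_zero]

theorem eval_confocalPoly_axis (i : Fin (n + 1)) :
    (confocalPoly a x).eval (a i) = x i ^ 2 * (cofactor a i).eval (a i) := by
  rw [confocalPoly, eval_add, eval_axesPoly_axis, eval_bilinPoly_axis, zero_add, sq]

theorem eval_axesPoly_ne_zero {z : ℝ} (hz : z ∉ Set.range a) : (axesPoly a).eval z ≠ 0 := by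
  rw [eval_axesPoly]
  exact Finset.prod_ne_zero_iff.2 fun k _ h => hz ⟨k, (sub_eq_zero.1 h).symm⟩

theorem eval_bilinPoly_of_notMem {z : ℝ} (hz : z ∉ Set.range a) :
    (bilinPoly a x y).eval z = -(axesPoly a).eval z * ∑ i, x i * y i / (a i - z) := by
  rw [eval_bilinPoly, Finset.mul_sum]
  refine Finset.sum_congr rfl fun i _ => ?_
  have h : a i - z ≠ 0 := fun h => hz ⟨i, sub_eq_zero.1 h⟩
  rw [← mul_cofactor i]
  simp only [eval_mul, eval_sub, eval_X, eval_C]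
  field_simp
  ring

theorem eval_confocalPoly_of_notMem {z : ℝ} (hz : z ∉ Set.range a) :
    (confocalPoly a x).eval z = (axesPoly a).eval z * (1 - ∑ i, x i ^ 2 / (a i - z)) := by
  rw [confocalPoly, eval_add, eval_bilinPoly_of_notMem hz]
  simp only [sq]
  ring

theorem bilinPoly_add_smul (t : ℝ) :
    bilinPoly a (x + t • v) y = bilinPoly a x y + C t * bilinPoly a v y := by
  simp only [bilinPoly, Finset.mul_sum, ← Finset.sum_add_distrib]
  refine Finset.sum_congr rfl fun i _ => ?_
  simp only [PiLp.add_apply, PiLp.smul_apply, smul_eq_mul, map_mul, map_add]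
  ring

theorem bilinPoly_comm : bilinPoly a x y = bilinPoly a y x := by
  simp only [bilinPoly, mul_comm]

theorem confocalPoly_add_smul (t : ℝ) :
    confocalPoly a (x + t • v) =
      confocalPoly a x + 2 * C t * bilinPoly a x v + C t ^ 2 * bilinPoly a v v := by
  rw [confocalPoly, confocalPoly, bilinPoly_add_smul, bilinPoly_comm (y := x + t • v),
    bilinPoly_comm (y := x + t • v), bilinPoly_add_smul, bilinPoly_add_smul,
    bilinPoly_comm (x := v) (y := x)]
  ring

theorem eval_confocalPoly_add_smul (t z : ℝ) :
    (confocalPoly a (x + t • v)).eval z = (confocalPoly a x).eval z +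
      2 * t * (bilinPoly a x v).eval z + t ^ 2 * (bilinPoly a v v).eval z := by
  simp [confocalPoly_add_smul]

/-- The sign of a product over `k ≠ j` whose terms are positive before `j`, negative after `j`. -/
theorem prod_erase_sign {n : ℕ} (f : Fin (n + 1) → ℝ) (j : Fin (n + 1)) (h1 : ∀ k < j, 0 < f k)
    (h2 : ∀ k, j < k → f k < 0) :
    0 < (-1) ^ (n - (j : ℕ)) * ∏ k ∈ Finset.univ.erase j, f k := by
  have h : ∏ k ∈ Finset.univ.erase j, (if j < k then (-1 : ℝ) else 1) = (-1) ^ (n - (j : ℕ)) := by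
    rw [Finset.prod_ite, Finset.prod_const_one, mul_one, Finset.prod_const]
    congr 1
    have : (Finset.univ.erase j).filter (fun k => j < k) = Finset.Ioi j := by
      ext k
      simp only [Finset.mem_filter, Finset.mem_erase, Finset.mem_univ, Finset.mem_Ioi, and_true,
        and_iff_right_iff_imp]
      exact fun h => h.ne'
    rw [this, Fin.card_Ioi]
    omega
  rw [← h, ← Finset.prod_mul_distrib]
  refine Finset.prod_pos fun k hk => ?_
  rcases lt_or_gt_of_ne (Finset.mem_erase.1 hk).1 with hlt | hlt
  · simpa [hlt.not_gt] using h1 k hlt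
  · simpa [hlt] using h2 k hlt

theorem cofactor_sign (ha : StrictMono a) (i : Fin (n + 1)) :
    0 < (-1) ^ (n - (i : ℕ)) * (cofactor a i).eval (a i) := by
  rw [eval_cofactor]
  exact prod_erase_sign _ i (fun k hk => sub_pos.2 (ha hk)) fun k hk => sub_neg.2 (ha hk)

theorem eval_cofactor_axis_ne_zero (ha : StrictMono a) (i : Fin (n + 1)) :
    (cofactor a i).eval (a i) ≠ 0 :=
  right_ne_zero_of_mul (cofactor_sign ha i).ne'

/-- Clearing denominators merges both cases of the definition: at `a i` only the `i`-th cofactor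
survives, with coefficient `x i ^ 2`. -/
theorem mem_confocalQuadric_iff (ha : StrictMono a) {z : ℝ} :
    x ∈ confocalQuadric a z ↔ (confocalPoly a x).eval z = 0 := by
  by_cases hz : z ∈ Set.range a
  · obtain ⟨i, rfl⟩ := hz
    rw [eval_confocalPoly_axis, mul_eq_zero, or_iff_left (eval_cofactor_axis_ne_zero ha i)]
    simp only [confocalQuadric, Set.mem_ofPred_eq, Set.mem_range_self, not_true_eq_false,
      false_and, or_false, sq_eq_zero_iff]
    refine ⟨?_, fun h => ⟨i, rfl, h⟩⟩
    rintro ⟨j, hj, h⟩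
    rwa [← ha.injective hj]
  · rw [eval_confocalPoly_of_notMem hz, mul_eq_zero, or_iff_right (eval_axesPoly_ne_zero hz),
      sub_eq_zero, eq_comm (a := (1 : ℝ))]
    simp only [confocalQuadric, Set.mem_ofPred_eq, hz, not_false_eq_true, true_and]
    exact or_iff_right fun ⟨j, hj, _⟩ => hz ⟨j, hj⟩

/-- A monic polynomial with as many given roots as its degree is the product of the linear factors. -/
theorem eq_prod_of_monic_of_roots {ι : Type*} [Fintype ι] {p : ℝ[X]} (hp : p.Monic) {r : ι → ℝ}
    (hr : Function.Injective r) (hd : p.natDegree = Fintype.card ι) (h : ∀ i, p.eval (r i) = 0) :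
    p = ∏ i, (X - C (r i)) := by
  classical
  have hm : (∏ i, (X - C (r i))).Monic := monic_prod_of_monic _ _ fun i _ => monic_X_sub_C _
  have hdeg : (∏ i, (X - C (r i))).natDegree = Fintype.card ι := by
    rw [natDegree_prod_of_monic _ _ fun i _ => monic_X_sub_C (r i)]
    simp
  -- Both polynomials are monic of the same degree, so their difference has fewer roots than there
  -- are `r i`, unless it is zero.
  refine eq_of_degree_sub_lt_of_eval_finset_eq (Finset.univ.image r) ?_ ?_
  · rw [Finset.card_image_of_injective _ hr, Finset.card_univ, ← hd,
      ← degree_eq_natDegree hp.ne_zero]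
    refine degree_sub_lt_left ?_ hp.ne_zero (by rw [hp, hm])
    rw [degree_eq_natDegree hp.ne_zero, degree_eq_natDegree hm.ne_zero, hd, hdeg]
  · intro z hz
    obtain ⟨i, -, rfl⟩ := Finset.mem_image.1 hz
    rw [h, eval_prod, Finset.prod_eq_zero (Finset.mem_univ i) (by simp)]

/-- The leading coefficient of `V` is `‖v‖² = 1`, and `W²` has degree at most `2n`, too low to
matter. -/
theorem monic_mul_sub_sq (hv : ‖v‖ = 1) :
    (bilinPoly a v v * confocalPoly a x - bilinPoly a x v ^ 2).Monic ∧
    (bilinPoly a v v * confocalPoly a x - bilinPoly a x v ^ 2).natDegree = n + 1 + n := by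
  have h1 : ∑ i, v i * v i = 1 := by
    have := EuclideanSpace.real_norm_sq_eq v
    rw [hv] at this
    simp only [sq] at this
    linarith
  have hc : (bilinPoly a v v).coeff n = 1 := by rw [coeff_bilinPoly, h1]
  have hV : (bilinPoly a v v).Monic := monic_of_natDegree_le_of_coeff_eq_one n
    natDegree_bilinPoly_le hc
  have hVd : (bilinPoly a v v).natDegree = n :=
    le_antisymm natDegree_bilinPoly_le (le_natDegree_of_ne_zero (by rw [hc]; exact one_ne_zero))
  have hm := hV.mul (monic_confocalPoly (a := a) (x := x))
  have hd : (bilinPoly a v v * confocalPoly a x).natDegree = n + 1 + n := by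
    rw [hV.natDegree_mul monic_confocalPoly, hVd, natDegree_confocalPoly]
    ring
  have hlt : (bilinPoly a x v ^ 2).degree < (bilinPoly a v v * confocalPoly a x).degree := by
    rw [degree_eq_natDegree hm.ne_zero, hd]
    refine degree_le_natDegree.trans_lt ?_
    have h2 : (bilinPoly a x v ^ 2).natDegree ≤ 2 * n :=
      natDegree_pow_le.trans (Nat.mul_le_mul_left 2 natDegree_bilinPoly_le)
    exact_mod_cast (by omega : (bilinPoly a x v ^ 2).natDegree < n + 1 + n)
  exact ⟨hm.sub_of_left hlt, by
    rw [natDegree_eq_of_degree_eq (degree_sub_eq_left_of_degree_lt hlt), hd]⟩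

/-- The three coefficients of the quadratic are `-V/D`, `-2W/D` and `-P/D`, so its discriminant is
`-4 (V P - W²) / D²`. -/
theorem tangentTo_iff {z : ℝ} (hz : z ∉ Set.range a) :
    TangentTo a z x v ↔
      (bilinPoly a v v * confocalPoly a x - bilinPoly a x v ^ 2).eval z = 0 := by
  have hD := eval_axesPoly_ne_zero hz
  rw [eval_sub, eval_mul, eval_pow, eval_bilinPoly_of_notMem hz, eval_bilinPoly_of_notMem hz,
    eval_confocalPoly_of_notMem hz, TangentTo, discrim]
  simp only [sq (v _)]
  constructor
  · intro h
    linear_combination (-(axesPoly a).eval z ^ 2 / 4) * h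
  · intro h
    have h4 : (axesPoly a).eval z ^ 2 ≠ 0 := pow_ne_zero 2 hD
    apply mul_left_cancel₀ h4
    linear_combination -4 * h

end Polynomials

/-- The polynomial identity that expresses tangency of the line `x + ℝ v` to the `Q_(l j)`. -/
def CausticIdentity {n : ℕ} (a : Fin (n + 1) → ℝ) (l : Fin n → ℝ)
    (x v : EuclideanSpace ℝ (Fin (n + 1))) : Prop :=
  bilinPoly a v v * confocalPoly a x - bilinPoly a x v ^ 2 =
    ∏ i, (X - C (Sum.elim a l i))

/-! ### Tangency to `n` confocal quadrics as one polynomial identity. -/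

section Caustics

variable {n : ℕ} {a : Fin (n + 1) → ℝ} {l : Fin n → ℝ} {x v : EuclideanSpace ℝ (Fin (n + 1))}

theorem causticIdentity_of_tangentTo (hal : Function.Injective (Sum.elim a l)) (hv : ‖v‖ = 1)
    (h : ∀ i, TangentTo a (l i) x v) : CausticIdentity a l x v := by
  obtain ⟨hm, hd⟩ := monic_mul_sub_sq (a := a) (x := x) hv
  refine eq_prod_of_monic_of_roots hm hal (by simpa using hd) ?_
  rintro (i | i)
  · simp only [Sum.elim_inl, eval_sub, eval_mul, eval_pow, eval_bilinPoly_axis,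
      eval_confocalPoly_axis]
    ring
  · refine (tangentTo_iff ?_).1 (h i)
    rintro ⟨k, hk⟩
    exact Sum.inl_ne_inr (hal (a₁ := Sum.inl k) (a₂ := Sum.inr i) hk)

/-- A discriminant is unchanged when the variable is translated. -/
theorem CausticIdentity.add_smul (h : CausticIdentity a l x v) (t : ℝ) :
    CausticIdentity a l (x + t • v) v := by
  rw [CausticIdentity] at h ⊢
  rw [← h, confocalPoly_add_smul, bilinPoly_add_smul]
  ring

theorem CausticIdentity.eval_eq (h : CausticIdentity a l x v) (z : ℝ) :
    (bilinPoly a v v).eval z * (confocalPoly a x).eval z - (bilinPoly a x v).eval z ^ 2 =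
      (∏ i, (z - a i)) * ∏ i, (z - l i) := by
  have := congrArg (eval z) h
  simpa [eval_prod] using this

/-- At a singular parameter the quadratic polynomial of the line does not vanish identically. -/
theorem CausticIdentity.not_all_zero (hal : Function.Injective (Sum.elim a l))
    (h : CausticIdentity a l x v) (z : ℝ) :
    ¬ ((bilinPoly a v v).eval z = 0 ∧ (bilinPoly a x v).eval z = 0 ∧
      (confocalPoly a x).eval z = 0) := by
  rintro ⟨h1, h2, h3⟩
  have hs : (∏ i, (X - C (Sum.elim a l i))).Separable := separable_prod_X_sub_C_iff.2 hal
  have h1' := dvd_iff_isRoot.2 h1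
  have h2' := dvd_iff_isRoot.2 h2
  have h3' := dvd_iff_isRoot.2 h3
  -- A common zero of `V`, `W` and `P` would be a double root of a squarefree product.
  have hd : (X - C z) * (X - C z) ∣ ∏ i, (X - C (Sum.elim a l i)) := by
    rw [← h, sq]
    exact dvd_sub (mul_dvd_mul h1' h3') (mul_dvd_mul h2' h2')
  exact not_isUnit_X_sub_C z (hs.squarefree _ hd)

theorem CausticIdentity.axis_ne_zero (hal : Function.Injective (Sum.elim a l))
    (h : CausticIdentity a l x v) (i : Fin (n + 1)) : x i ≠ 0 ∨ v i ≠ 0 := by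
  by_contra! hc
  refine h.not_all_zero hal (a i) ⟨?_, ?_, ?_⟩
  · rw [eval_bilinPoly_axis, hc.2]; ring
  · rw [eval_bilinPoly_axis, hc.2]; ring
  · rw [eval_confocalPoly_axis, hc.1]; ring

end Caustics

end

end EllipsoidBilliard

/-! ### Interlacing of semi-axes and caustic parameters. -/

namespace EllipsoidBilliard

open Polynomial

noncomputable section

/-- The order relations between the squared semi-axes and nonsingular caustic parameters. -/
structure Interlaced {n : ℕ} (a : Fin (n + 1) → ℝ) (l : Fin n → ℝ) : Prop where
  axis_pos : 0 < a 0
  axis_mono : StrictMono a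
  caustic_pos : ∀ i, 0 < l i
  caustic_mono : StrictMono l
  caustic_lt : ∀ i, l i < a i.succ
  lt_caustic : ∀ i j : Fin n, i < j → a i.castSucc < l j
  ne : ∀ i, l i ≠ a i.castSucc

/-- The left ends of the intervals in which the elliptic coordinates oscillate. -/
def lowerEnd {n : ℕ} (a : Fin (n + 1) → ℝ) (l : Fin n → ℝ) : Fin (n + 1) → ℝ :=
  Fin.cons 0 fun i => max (a i.castSucc) (l i)

/-- The right ends of the intervals in which the elliptic coordinates oscillate. -/
def upperEnd {n : ℕ} (a : Fin (n + 1) → ℝ) (l : Fin n → ℝ) : Fin (n + 1) → ℝ :=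
  Fin.snoc (α := fun _ => ℝ) (fun i => min (a i.castSucc) (l i)) (a (Fin.last n))

/-- The list of the ends of these intervals. -/
def endList {n : ℕ} (a : Fin (n + 1) → ℝ) (l : Fin n → ℝ) (k : Fin (2 * n + 2)) : ℝ :=
  if (k : ℕ) % 2 = 0 then lowerEnd a l ⟨k / 2, by omega⟩ else upperEnd a l ⟨k / 2, by omega⟩

section Interlacing

variable {n : ℕ} {a : Fin (n + 1) → ℝ} {l : Fin n → ℝ}

theorem axes₀_strictMono (ha : NondegenerateAxes a) : StrictMono (axes₀ a) := by
  refine Fin.strictMono_iff_lt_succ.2 fun i => ?_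
  refine Fin.cases ?_ (fun i => ?_) i
  · simpa [axes₀] using ha.1
  · simp only [axes₀, Fin.cons_succ, ← Fin.succ_castSucc]
    exact ha.2 i.castSucc_lt_succ

theorem causticComponent_subset (σ : Fin n → Fin 2) :
    causticComponent a σ ⊆ causticSpace a := by
  rintro l ⟨h1, h2, h3⟩
  refine ⟨h1, h2, fun i => ?_⟩
  have h := h3 i
  rcases (by omega : σ i = 0 ∨ σ i = 1) with e | e <;> simp only [e] at h
  · exact Or.inl h
  · exact Or.inr h

theorem interlaced_of_mem_causticSpace (ha : NondegenerateAxes a) (hl : l ∈ causticSpace a) :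
    Interlaced a l := by
  obtain ⟨h1, h2, h3⟩ := hl
  have hm := axes₀_strictMono ha
  have e1 : ∀ i : Fin n, axes₀ a i.succ.castSucc = a i.castSucc := fun i => by
    rw [← Fin.succ_castSucc]; rfl
  have e2 : ∀ i : Fin n, axes₀ a i.succ.succ = a i.succ := fun i => rfl
  refine ⟨ha.1, ha.2, h1, h2, fun i => ?_, fun i j hij => ?_, fun i => ?_⟩
  · rcases h3 i with h | h
    · rw [e1] at h
      exact h.2.trans (ha.2 i.castSucc_lt_succ)
    · exact h.2
  · have hlt : axes₀ a j.castSucc.castSucc < l j := by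
      rcases h3 j with h | h
      · exact h.1
      · exact (hm (Fin.castSucc_lt_castSucc_iff.2 j.castSucc_lt_succ)).trans h.1
    rw [← e1]
    exact (hm.monotone (show i.succ.castSucc ≤ j.castSucc.castSucc from hij)).trans_lt hlt
  · rcases h3 i with h | h
    · rw [e1] at h
      exact h.2.ne
    · rw [e1] at h
      exact h.1.ne'

@[simp] theorem lowerEnd_zero : lowerEnd a l 0 = 0 := rfl

@[simp] theorem lowerEnd_succ (i : Fin n) : lowerEnd a l i.succ = max (a i.castSucc) (l i) := rfl

@[simp] theorem upperEnd_castSucc (i : Fin n) :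
    upperEnd a l i.castSucc = min (a i.castSucc) (l i) := by
  simp [upperEnd]

@[simp] theorem upperEnd_last : upperEnd a l (Fin.last n) = a (Fin.last n) := by
  simp [upperEnd]

theorem endList_even (j : Fin (n + 1)) : endList a l ⟨2 * j, by omega⟩ = lowerEnd a l j := by
  simp [endList]

theorem endList_odd (j : Fin (n + 1)) : endList a l ⟨2 * j + 1, by omega⟩ = upperEnd a l j := by
  have h : (2 * (j : ℕ) + 1) / 2 = j := by omega
  have h' : (2 * (j : ℕ) + 1) % 2 = 1 := by omega
  simp [endList, h, h']

theorem Interlaced.caustic_lt_of_lt (h : Interlaced a l) {i : Fin n} {j : Fin (n + 1)}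
    (hij : i.castSucc < j) : l i < a j :=
  (h.caustic_lt i).trans_le (h.axis_mono.monotone (Fin.castSucc_lt_iff_succ_le.1 hij))

theorem Interlaced.injective (h : Interlaced a l) : Function.Injective (Sum.elim a l) := by
  refine h.axis_mono.injective.sumElim h.caustic_mono.injective fun k i hki => ?_
  rcases lt_trichotomy i.castSucc k with hlt | rfl | hlt
  · exact (h.caustic_lt_of_lt hlt).ne' hki
  · exact h.ne i hki.symm
  · have : a k < l i := by
      have := h.lt_caustic ⟨k, (Fin.lt_def.1 hlt).trans i.isLt⟩ i hlt
      exact this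
    exact this.ne hki

theorem Interlaced.lowerEnd_lt_axis (h : Interlaced a l) (j : Fin (n + 1)) :
    lowerEnd a l j < a j := by
  refine Fin.cases ?_ (fun i => ?_) j
  · exact h.axis_pos
  · rw [lowerEnd_succ]
    exact max_lt (h.axis_mono i.castSucc_lt_succ) (h.caustic_lt i)

theorem Interlaced.lowerEnd_lt_caustic (h : Interlaced a l) (i : Fin n) :
    lowerEnd a l i.castSucc < l i := by
  obtain ⟨n, rfl⟩ : ∃ m, n = m + 1 := ⟨n - 1, by have := i.isLt; omega⟩
  refine Fin.cases ?_ (fun k => ?_) i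
  · exact h.caustic_pos 0
  · rw [← Fin.succ_castSucc, lowerEnd_succ]
    exact max_lt (h.lt_caustic _ _ k.castSucc_lt_succ) (h.caustic_mono k.castSucc_lt_succ)

theorem Interlaced.lowerEnd_lt_upperEnd (h : Interlaced a l) (j : Fin (n + 1)) :
    lowerEnd a l j < upperEnd a l j := by
  refine Fin.lastCases ?_ (fun i => ?_) j
  · rw [upperEnd_last]
    exact h.lowerEnd_lt_axis _
  · rw [upperEnd_castSucc]
    exact lt_min (h.lowerEnd_lt_axis _) (h.lowerEnd_lt_caustic i)

theorem Interlaced.upperEnd_lt_lowerEnd (h : Interlaced a l) (i : Fin n) :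
    upperEnd a l i.castSucc < lowerEnd a l i.succ := by
  rw [upperEnd_castSucc, lowerEnd_succ]
  exact min_lt_max.2 (h.ne i).symm

theorem Interlaced.strictMono_endList (h : Interlaced a l) : StrictMono (endList a l) := by
  refine Fin.strictMono_iff_lt_succ.2 fun k => ?_
  rcases Nat.even_or_odd' (k : ℕ) with ⟨j, hj | hj⟩
  · have hjn : j < n + 1 := by omega
    rw [show k.castSucc = ⟨2 * ((⟨j, hjn⟩ : Fin (n + 1)) : ℕ), by omega⟩ from Fin.ext hj,
      show k.succ = ⟨2 * ((⟨j, hjn⟩ : Fin (n + 1)) : ℕ) + 1, by omega⟩ from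
        Fin.ext (congrArg (· + 1) hj), endList_even, endList_odd]
    exact h.lowerEnd_lt_upperEnd _
  · have hjn : j < n := by omega
    rw [show k.castSucc = ⟨2 * ((⟨j, hjn⟩ : Fin n).castSucc : ℕ) + 1, by simp; omega⟩ from Fin.ext hj,
      show k.succ = ⟨2 * ((⟨j, hjn⟩ : Fin n).succ : ℕ), by simp; omega⟩ from
        Fin.ext (by simp; omega), endList_even, endList_odd]
    exact h.upperEnd_lt_lowerEnd _

theorem Interlaced.strictMono_lowerEnd (h : Interlaced a l) : StrictMono (lowerEnd a l) := by
  intro i j hij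
  rw [← endList_even, ← endList_even]
  refine h.strictMono_endList ?_
  rw [Fin.lt_def] at hij ⊢
  simp only
  omega

theorem Interlaced.strictMono_upperEnd (h : Interlaced a l) : StrictMono (upperEnd a l) := by
  intro i j hij
  rw [← endList_odd, ← endList_odd]
  refine h.strictMono_endList ?_
  rw [Fin.lt_def] at hij ⊢
  simp only
  omega

theorem Interlaced.upperEnd_lt_lowerEnd_of_lt (h : Interlaced a l) {i j : Fin (n + 1)}
    (hij : i < j) : upperEnd a l i < lowerEnd a l j := by
  rw [← endList_even, ← endList_odd]
  refine h.strictMono_endList ?_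
  rw [Fin.lt_def] at hij ⊢
  simp only
  omega

theorem Interlaced.lowerEnd_nonneg (h : Interlaced a l) (j : Fin (n + 1)) : 0 ≤ lowerEnd a l j := by
  rw [← lowerEnd_zero (a := a) (l := l)]
  exact h.strictMono_lowerEnd.monotone (Fin.zero_le j)

theorem upperEnd_mem (j : Fin (n + 1)) : upperEnd a l j ∈ Set.range a ∪ Set.range l := by
  refine Fin.lastCases ?_ (fun i => ?_) j
  · exact Or.inl ⟨_, upperEnd_last.symm⟩
  · rw [upperEnd_castSucc]
    rcases min_choice (a i.castSucc) (l i) with e | e <;> rw [e]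
    · exact Or.inl ⟨_, rfl⟩
    · exact Or.inr ⟨_, rfl⟩

theorem lowerEnd_succ_mem (i : Fin n) : lowerEnd a l i.succ ∈ Set.range a ∪ Set.range l := by
  rw [lowerEnd_succ]
  rcases max_choice (a i.castSucc) (l i) with e | e <;> rw [e]
  · exact Or.inl ⟨_, rfl⟩
  · exact Or.inr ⟨_, rfl⟩

theorem Interlaced.isOrderedList_endList (h : Interlaced a l) :
    IsOrderedList a l (endList a l) := by
  refine ⟨endList_even 0, h.strictMono_endList, Set.Subset.antisymm ?_ ?_⟩
  · rintro _ ⟨k, rfl⟩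
    change endList a l k.succ ∈ _
    rcases Nat.even_or_odd' (k : ℕ) with ⟨j, hj | hj⟩
    · have hjn : j < n + 1 := by omega
      have e : k.succ = ⟨2 * ((⟨j, hjn⟩ : Fin (n + 1)) : ℕ) + 1, by omega⟩ :=
        Fin.ext (congrArg (· + 1) hj)
      rw [e, endList_odd]
      exact upperEnd_mem _
    · have hjn : j < n := by omega
      have e : k.succ = ⟨2 * ((⟨j, hjn⟩ : Fin n).succ : ℕ), by simp; omega⟩ :=
        Fin.ext (by simp; omega)
      rw [e, endList_even]
      exact lowerEnd_succ_mem _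
  · have hu : ∀ j, upperEnd a l j ∈ Set.range fun i : Fin (2 * n + 1) => endList a l i.succ :=
      fun j => ⟨⟨2 * j, by omega⟩, endList_odd j⟩
    have hl : ∀ i : Fin n, lowerEnd a l i.succ ∈
        Set.range fun i : Fin (2 * n + 1) => endList a l i.succ :=
      fun i => ⟨⟨2 * i + 1, by omega⟩, endList_even i.succ⟩
    rintro _ (⟨k, rfl⟩ | ⟨i, rfl⟩)
    · refine Fin.lastCases ?_ (fun i => ?_) k
      · rw [← upperEnd_last (a := a) (l := l)]
        exact hu _
      · rcases le_total (a i.castSucc) (l i) with e | e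
        · have := hu i.castSucc
          rwa [upperEnd_castSucc, min_eq_left e] at this
        · have := hl i
          rwa [lowerEnd_succ, max_eq_left e] at this
    · rcases le_total (a i.castSucc) (l i) with e | e
      · have := hl i
        rwa [lowerEnd_succ, max_eq_right e] at this
      · have := hu i.castSucc
        rwa [upperEnd_castSucc, min_eq_right e] at this

/-- A strictly increasing list is determined by its range; this replaces the list quantified in
`HasWindingNumbers` by the explicit one. -/
theorem Interlaced.isOrderedList_unique (h : Interlaced a l) {c : Fin (2 * n + 2) → ℝ}
    (hc : IsOrderedList a l c) : c = endList a l := by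
  obtain ⟨h0, hm, hr⟩ := hc
  obtain ⟨h0', hm', hr'⟩ := h.isOrderedList_endList
  have := ((hm.comp (Fin.strictMono_succ (n := 2 * n + 1))).range_inj
    (hm'.comp (Fin.strictMono_succ (n := 2 * n + 1)))).1 (hr.trans hr'.symm)
  funext k
  refine Fin.cases (h0.trans h0'.symm) (fun i => ?_) k
  exact congrFun this i

/-- Away from the gap between `a i` and `l i`, the corresponding factors have the same sign. -/
theorem factor_pos {z : ℝ} {i : Fin n}
    (hz : z < upperEnd a l i.castSucc ∨ lowerEnd a l i.succ < z) :
    0 < (z - a i.castSucc) * (z - l i) := by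
  rw [upperEnd_castSucc, lowerEnd_succ, lt_min_iff, max_lt_iff] at hz
  rcases hz with hz | hz
  · exact mul_pos_of_neg_of_neg (sub_neg.2 hz.1) (sub_neg.2 hz.2)
  · exact mul_pos (sub_pos.2 hz.1) (sub_pos.2 hz.2)

theorem prod_factors (z : ℝ) : (∏ i, (z - a i)) * ∏ i, (z - l i) =
    (∏ i : Fin n, (z - a i.castSucc) * (z - l i)) * (z - a (Fin.last n)) := by
  rw [Fin.prod_univ_castSucc, Finset.prod_mul_distrib]
  ring

/-- Each `l i` is paired with `a i`; every pair contributes a positive factor, and the unpaired `z -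
a n` is negative. -/
theorem Interlaced.prod_factors_neg (h : Interlaced a l) {z : ℝ} {j : Fin (n + 1)}
    (hz : z ∈ Set.Ioo (lowerEnd a l j) (upperEnd a l j)) :
    (∏ i, (z - a i)) * ∏ i, (z - l i) < 0 := by
  rw [prod_factors]
  refine mul_neg_of_pos_of_neg (Finset.prod_pos fun i _ => factor_pos ?_) (sub_neg.2 ?_)
  · rcases lt_or_ge i.castSucc j with hij | hij
    · exact Or.inr ((h.strictMono_lowerEnd.monotone (Fin.castSucc_lt_iff_succ_le.1 hij)).trans_lt
        hz.1)
    · exact Or.inl (hz.2.trans_le (h.strictMono_upperEnd.monotone hij))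
  · rw [← upperEnd_last (a := a) (l := l)]
    exact hz.2.trans_le (h.strictMono_upperEnd.monotone (Fin.le_last j))

/-- In the gap the pair `i` turns negative as well, which compensates the negative last factor. -/
theorem Interlaced.prod_factors_pos (h : Interlaced a l) {z : ℝ} {i : Fin n}
    (hz : z ∈ Set.Ioo (upperEnd a l i.castSucc) (lowerEnd a l i.succ)) :
    0 < (∏ i, (z - a i)) * ∏ i, (z - l i) := by
  rw [prod_factors, ← Finset.mul_prod_erase _ _ (Finset.mem_univ i)]
  refine mul_pos_of_neg_of_neg (mul_neg_of_neg_of_pos ?_ (Finset.prod_pos fun k hk =>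
    factor_pos ?_)) (sub_neg.2 ?_)
  · rw [upperEnd_castSucc, lowerEnd_succ] at hz
    rcases le_total (a i.castSucc) (l i) with e | e
    · rw [min_eq_left e, max_eq_right e] at hz
      exact mul_neg_of_pos_of_neg (sub_pos.2 hz.1) (sub_neg.2 hz.2)
    · rw [min_eq_right e, max_eq_left e] at hz
      exact mul_neg_of_neg_of_pos (sub_neg.2 hz.2) (sub_pos.2 hz.1)
  · rcases lt_or_gt_of_ne (Finset.mem_erase.1 hk).1 with hki | hki
    · refine Or.inr (lt_of_le_of_lt ?_ hz.1)
      exact (h.strictMono_lowerEnd.monotone (Fin.castSucc_lt_iff_succ_le.1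
        (Fin.castSucc_lt_castSucc_iff.2 hki))).trans (h.lowerEnd_lt_upperEnd _).le
    · refine Or.inl (hz.2.trans_le ?_)
      exact (h.lowerEnd_lt_upperEnd _).le.trans (h.strictMono_upperEnd.monotone
        (Fin.castSucc_lt_iff_succ_le.1 (Fin.castSucc_lt_castSucc_iff.2 hki)))
  · exact hz.2.trans_le ((h.lowerEnd_lt_axis _).le.trans (h.axis_mono.monotone (Fin.le_last _)))

end Interlacing

/-- A function without zeros on an open interval keeps there its sign at an end. -/
theorem pos_of_ne_zero_between {f : ℝ → ℝ} (hf : Continuous f) {u w : ℝ} (hu : 0 < f u)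
    (hne : ∀ z ∈ Set.Ioo (min u w) (max u w), f z ≠ 0) :
    ∀ z ∈ Set.Ioo (min u w) (max u w), 0 < f z := by
  intro z hz
  by_contra! hle
  have h0 : (0 : ℝ) ∈ f '' Set.uIcc u z :=
    intermediate_value_uIcc hf.continuousOn (Set.mem_uIcc.2 (Or.inr ⟨hle, hu.le⟩))
  obtain ⟨y, hy, hfy⟩ := h0
  refine hne y ?_ hfy
  have hyu : y ≠ u := fun e => hu.ne' (e ▸ hfy)
  rcases le_total u w with e | e
  · rw [min_eq_left e, max_eq_right e] at hz ⊢
    rw [Set.uIcc_of_le hz.1.le] at hy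
    exact ⟨lt_of_le_of_ne hy.1 hyu.symm, hy.2.trans_lt hz.2⟩
  · rw [min_eq_right e, max_eq_left e] at hz ⊢
    rw [Set.uIcc_of_ge hz.2.le] at hy
    exact ⟨hz.1.trans_le hy.1, lt_of_le_of_ne hy.2 hyu⟩

/-- A function that is positive on an open interval is nonnegative at its ends. -/
theorem nonneg_of_pos_between {f : ℝ → ℝ} (hf : Continuous f) {u w : ℝ} (huw : u < w)
    (hpos : ∀ z ∈ Set.Ioo u w, 0 < f z) : ∀ z ∈ Set.Icc u w, 0 ≤ f z := by
  rw [← closure_Ioo huw.ne]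
  exact fun z hz => closure_minimal (fun y hy => (hpos y hy).le : Set.Ioo u w ⊆ {y | 0 ≤ f y})
    (isClosed_le continuous_const hf) hz

/-! ### Elliptic coordinates along a line of the trajectory. -/

section EllipticCoordinates

variable {n : ℕ} {a : Fin (n + 1) → ℝ} {l : Fin n → ℝ} {x v : EuclideanSpace ℝ (Fin (n + 1))}

/-- The sign of the characteristic polynomial in the gap between `a i` and `l i`. -/
theorem CausticIdentity.gap_sign (h : Interlaced a l) (hc : CausticIdentity a l x v) (i : Fin n) :
    ∀ z ∈ Set.Icc (upperEnd a l i.castSucc) (lowerEnd a l i.succ),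
      0 ≤ (-1) ^ (n - (i : ℕ)) * (confocalPoly a x).eval z := by
  have hs := cofactor_sign h.axis_mono i.castSucc
  rw [Fin.val_castSucc] at hs
  have hVP : ∀ z ∈ Set.Ioo (upperEnd a l i.castSucc) (lowerEnd a l i.succ),
      0 < (bilinPoly a v v).eval z * (confocalPoly a x).eval z := fun z hz => by
    have := h.prod_factors_pos hz
    rw [← hc.eval_eq] at this
    nlinarith [sq_nonneg ((bilinPoly a x v).eval z)]
  have hsgn : (-1 : ℝ) ^ (n - (i : ℕ)) ≠ 0 := pow_ne_zero _ (by norm_num)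
  have hsq : (-1 : ℝ) ^ (n - (i : ℕ)) * (-1) ^ (n - (i : ℕ)) = 1 := by
    rw [← mul_pow]; norm_num
  have hcP : Continuous fun z => (-1 : ℝ) ^ (n - (i : ℕ)) * (confocalPoly a x).eval z := by fun_prop
  have hcV : Continuous fun z => (-1 : ℝ) ^ (n - (i : ℕ)) * (bilinPoly a v v).eval z := by fun_prop
  refine nonneg_of_pos_between hcP (h.upperEnd_lt_lowerEnd i) ?_
  rw [upperEnd_castSucc, lowerEnd_succ] at hVP ⊢
  -- `a i` is an end of the gap. If `x i ≠ 0`, the sign of `P` is known there; otherwise that of `V`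
  -- is, and `V P > 0` in the gap transfers it to `P`.
  rcases hc.axis_ne_zero h.injective i.castSucc with hx | hv
  · refine pos_of_ne_zero_between hcP ?_ fun z hz => ?_
    · rw [eval_confocalPoly_axis, mul_left_comm]
      positivity
    · exact mul_ne_zero hsgn (right_ne_zero_of_mul (hVP z hz).ne')
  · intro z hz
    have : 0 < (-1 : ℝ) ^ (n - (i : ℕ)) * (bilinPoly a v v).eval z := by
      refine pos_of_ne_zero_between hcV ?_ (fun z hz => ?_) z hz
      · rw [eval_bilinPoly_axis, mul_left_comm]
        have := mul_self_pos.2 hv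
        positivity
      · exact mul_ne_zero hsgn (left_ne_zero_of_mul (hVP z hz).ne')
    refine pos_of_mul_pos_right (a := (-1 : ℝ) ^ (n - (i : ℕ)) * (bilinPoly a v v).eval z) ?_ this.le
    calc 0 < (bilinPoly a v v).eval z * (confocalPoly a x).eval z := hVP z hz
      _ = ((-1 : ℝ) ^ (n - (i : ℕ)) * (-1) ^ (n - (i : ℕ))) *
          ((bilinPoly a v v).eval z * (confocalPoly a x).eval z) := by rw [hsq, one_mul]
      _ = _ := by ring

theorem upperEnd_sign (h : Interlaced a l) (hc : CausticIdentity a l x v) (j : Fin (n + 1)) :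
    0 ≤ (-1) ^ (n - (j : ℕ)) * (confocalPoly a x).eval (upperEnd a l j) := by
  refine Fin.lastCases ?_ (fun i => ?_) j
  · rw [upperEnd_last, eval_confocalPoly_axis, mul_left_comm]
    exact mul_nonneg (sq_nonneg _) (cofactor_sign h.axis_mono _).le
  · exact hc.gap_sign h i _ (Set.left_mem_Icc.2 (h.upperEnd_lt_lowerEnd i).le)

theorem eval_confocalPoly_zero (h : Interlaced a l) (x : EuclideanSpace ℝ (Fin (n + 1))) :
    (-1) ^ (n + 1) * (confocalPoly a x).eval 0 = (∏ i, a i) * (1 - ∑ i, x i ^ 2 / a i) := by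
  have hpos : ∀ i, 0 < a i := fun i =>
    h.axis_pos.trans_le (h.axis_mono.monotone (Fin.zero_le i))
  rw [eval_confocalPoly_of_notMem fun ⟨i, hi⟩ => (hpos i).ne' hi, eval_axesPoly, ← mul_assoc]
  simp only [zero_sub, sub_zero, Finset.prod_neg, Finset.card_univ, Fintype.card_fin]
  rw [← mul_assoc, ← mul_pow]
  norm_num

/-- At the end `0` the sign expresses that `x` is not outside the ellipsoid. Any other lower end
closes the gap of the preceding index, hence the opposite sign. -/
theorem lowerEnd_sign (h : Interlaced a l) (hc : CausticIdentity a l x v)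
    (hx : ∑ i, x i ^ 2 / a i ≤ 1) (j : Fin (n + 1)) :
    (-1) ^ (n - (j : ℕ)) * (confocalPoly a x).eval (lowerEnd a l j) ≤ 0 := by
  refine Fin.cases ?_ (fun i => ?_) j
  · have h0 := eval_confocalPoly_zero h x
    have hp : 0 ≤ (∏ i, a i) * (1 - ∑ i, x i ^ 2 / a i) :=
      mul_nonneg (Finset.prod_nonneg fun i _ =>
        (h.axis_pos.trans_le (h.axis_mono.monotone (Fin.zero_le i))).le) (sub_nonneg.2 hx)
    rw [← h0, pow_succ] at hp
    simp only [lowerEnd_zero, Fin.val_zero, Nat.sub_zero]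
    linarith
  · have h0 := hc.gap_sign h i _ (Set.right_mem_Icc.2 (h.upperEnd_lt_lowerEnd i).le)
    have e : n - (i : ℕ) = n - (i.succ : ℕ) + 1 := by
      have := i.isLt
      rw [Fin.val_succ]
      omega
    rw [e, pow_succ] at h0
    linarith

/-- The elliptic coordinates of a point of the trajectory. -/
theorem exists_elliptic_coordinates (h : Interlaced a l) (hc : CausticIdentity a l x v)
    (hx : ∑ i, x i ^ 2 / a i ≤ 1) :
    ∃ μ : Fin (n + 1) → ℝ, (∀ j, μ j ∈ Set.Icc (lowerEnd a l j) (upperEnd a l j)) ∧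
      confocalPoly a x = ∏ j, (X - C (μ j)) := by
  have hr : ∀ j, ∃ m ∈ Set.Icc (lowerEnd a l j) (upperEnd a l j),
      (confocalPoly a x).eval m = 0 := fun j => by
    have hcP : Continuous fun z => (-1 : ℝ) ^ (n - (j : ℕ)) * (confocalPoly a x).eval z := by
      fun_prop
    obtain ⟨m, hm, h0⟩ := intermediate_value_Icc (h.lowerEnd_lt_upperEnd j).le hcP.continuousOn
      ⟨lowerEnd_sign h hc hx j, upperEnd_sign h hc j⟩
    exact ⟨m, hm, (mul_eq_zero.1 h0).resolve_left (pow_ne_zero _ (by norm_num))⟩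
  choose μ hμ h0 using hr
  have hmono : StrictMono μ := fun i j hij =>
    ((hμ i).2.trans_lt (h.upperEnd_lt_lowerEnd_of_lt hij)).trans_le (hμ j).1
  exact ⟨μ, hμ, eq_prod_of_monic_of_roots monic_confocalPoly hmono.injective
    (by simpa using natDegree_confocalPoly) h0⟩

variable {μ : Fin (n + 1) → ℝ}

theorem eval_confocalPoly_eq_zero_iff (h : Interlaced a l)
    (hμ : ∀ j, μ j ∈ Set.Icc (lowerEnd a l j) (upperEnd a l j))
    (hP : confocalPoly a x = ∏ j, (X - C (μ j))) {z : ℝ} {j : Fin (n + 1)}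
    (hz : z ∈ Set.Icc (lowerEnd a l j) (upperEnd a l j)) :
    (confocalPoly a x).eval z = 0 ↔ μ j = z := by
  rw [hP, eval_prod, Finset.prod_eq_zero_iff]
  simp only [eval_sub, eval_X, eval_C, Finset.mem_univ, true_and, sub_eq_zero]
  refine ⟨?_, fun e => ⟨j, e.symm⟩⟩
  rintro ⟨k, rfl⟩
  rcases lt_trichotomy k j with hkj | rfl | hkj
  · exact absurd ((hμ k).2.trans_lt (h.upperEnd_lt_lowerEnd_of_lt hkj)) hz.1.not_gt
  · rfl
  · exact absurd (hz.2.trans_lt (h.upperEnd_lt_lowerEnd_of_lt hkj)) (hμ k).1.not_gt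

/-- In the `j`-th interval the factors `z - μ k` with `k ≠ j` have fixed signs, so the sign of `P`
at `z` locates `μ j` relative to `z`. -/
theorem eval_confocalPoly_sign (h : Interlaced a l)
    (hμ : ∀ j, μ j ∈ Set.Icc (lowerEnd a l j) (upperEnd a l j))
    (hP : confocalPoly a x = ∏ j, (X - C (μ j))) {z : ℝ} {j : Fin (n + 1)}
    (hz : z ∈ Set.Icc (lowerEnd a l j) (upperEnd a l j)) :
    ∃ r : ℝ, 0 < r ∧ (-1) ^ (n - (j : ℕ)) * (confocalPoly a x).eval z = r * (z - μ j) := by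
  refine ⟨_, prod_erase_sign (fun k => z - μ k) j (fun k hk => sub_pos.2 ?_)
    fun k hk => sub_neg.2 ?_, ?_⟩
  · exact ((hμ k).2.trans_lt (h.upperEnd_lt_lowerEnd_of_lt hk)).trans_le hz.1
  · exact (hz.2.trans_lt (h.upperEnd_lt_lowerEnd_of_lt hk)).trans_le (hμ k).1
  · rw [hP, eval_prod, mul_assoc, Finset.prod_erase_mul _ _ (Finset.mem_univ j)]
    simp

end EllipticCoordinates

end

end EllipsoidBilliard

/-! ### Oscillation of periodic functions and sign changes of periodic sequences. -/

namespace EllipsoidBilliard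

section PeriodicFunctions

variable {f : ℝ → ℝ} {T c d : ℝ}

/-- Rolle: without local maxima strictly between the levels `c` and `d`, the function attains the
upper level `d` between two visits of the lower level `c`. -/
theorem exists_upper_between (hf : Continuous f) (hfd : ∀ t, f t ≤ d) (hfc : ∀ t, c ≤ f t)
    (hmax : ∀ t, c < f t → f t < d → ¬ IsLocalMax f t)
    (hne : ∀ u w, u < w → ∃ t ∈ Set.Ioo u w, f t ≠ c) {u w : ℝ} (huw : u < w)
    (hu : f u = c) (hw : f w = c) : ∃ t ∈ Set.Ioo u w, f t = d := by
  obtain ⟨t, ht, htmax⟩ := isCompact_Icc.exists_isMaxOn (Set.nonempty_Icc.2 huw.le)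
    (hf.continuousOn (s := Set.Icc u w))
  obtain ⟨r, hr, hrc⟩ := hne u w huw
  have hct : c < f t := (lt_of_le_of_ne (hfc r) hrc.symm).trans_le (htmax (Set.Ioo_subset_Icc_self hr))
  have htu : t ≠ u := fun e => hct.ne' (e ▸ hu)
  have htw : t ≠ w := fun e => hct.ne' (e ▸ hw)
  have ht' : t ∈ Set.Ioo u w := ⟨lt_of_le_of_ne ht.1 htu.symm, lt_of_le_of_ne ht.2 htw⟩
  refine ⟨t, ht', ?_⟩
  by_contra htd
  exact hmax t hct (lt_of_le_of_ne (hfd t) htd) (htmax.isLocalMax (Icc_mem_nhds ht'.1 ht'.2))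

/-- A periodic function without local maxima strictly between two levels visits the upper level,
along a period, at least as often as the lower one. -/
theorem encard_lower_le_encard_upper (hf : Continuous f) (hT : 0 < T) (hp : Function.Periodic f T)
    (hcd : c < d) (hfd : ∀ t, f t ≤ d) (hfc : ∀ t, c ≤ f t)
    (hmax : ∀ t, c < f t → f t < d → ¬ IsLocalMax f t)
    (hne : ∀ u w, u < w → ∃ t ∈ Set.Ioo u w, f t ≠ c) :
    {t ∈ Set.Ico 0 T | f t = c}.encard ≤ {t ∈ Set.Ico 0 T | f t = d}.encard := by
  have rolle : ∀ {u w : ℝ}, u < w → f u = c → f w = c → ∃ t ∈ Set.Ioo u w, f t = d :=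
    fun h1 h2 h3 => exists_upper_between hf hfd hfc hmax hne h1 h2 h3
  have hnext : ∀ u, f u = c → ∃ b, (u ≤ b ∧ f b = d) ∧ ∀ b', u ≤ b' → f b' = d → b ≤ b' := by
    intro u hu
    obtain ⟨b, hb, hbd⟩ := rolle (lt_add_of_pos_right u hT) hu ((hp u).trans hu)
    have hcl : IsClosed {b | u ≤ b ∧ f b = d} :=
      isClosed_Ici.inter (isClosed_eq hf continuous_const)
    have hbdd : BddBelow {b | u ≤ b ∧ f b = d} := ⟨u, fun b hb => hb.1⟩
    exact ⟨_, hcl.csInf_mem ⟨b, hb.1.le, hbd⟩ hbdd, fun b' h1 h2 => csInf_le hbdd ⟨h1, h2⟩⟩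
  choose! next hnext hleast using hnext
  have hlt : ∀ u, f u = c → u < next u := fun u hu =>
    lt_of_le_of_ne (hnext u hu).1 fun e => hcd.ne (by rw [← hu, ← (hnext u hu).2, ← e])
  -- The injection sends a lower visit to the first upper visit after it, reduced modulo the period.
  refine Set.encard_le_encard_of_injOn (f := fun u => toIcoMod hT 0 (next u)) ?_ ?_
  · rintro u ⟨-, hu⟩
    refine ⟨by simpa using toIcoMod_mem_Ico hT 0 (next u), ?_⟩
    change f (next u - toIcoDiv hT 0 (next u) • T) = d
    rw [zsmul_eq_mul, hp.sub_int_mul_eq]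
    exact (hnext u hu).2
  · rintro u ⟨hu0, hu⟩ w ⟨hw0, hw⟩ huw
    obtain ⟨k, hk⟩ : ∃ k : ℤ, next u = next w + k * T := by
      refine ⟨toIcoDiv hT 0 (next u) - toIcoDiv hT 0 (next w), ?_⟩
      simp only [toIcoMod, zsmul_eq_mul] at huw
      push_cast
      linarith
    have hwk : f (w + k * T) = c := (hp.int_mul k w).trans hw
    have hwn := hlt w hw
    have hun := hlt u hu
    -- Two distinct lower visits with the same next upper visit would have another upper visit
    -- between them, against minimality.
    have heq : u = w + k * T := by
      rcases lt_trichotomy u (w + k * T) with h | h | h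
      · obtain ⟨b, hb, hbd⟩ := rolle h hu hwk
        have := hleast u hu b hb.1.le hbd
        linarith [hb.2]
      · exact h
      · obtain ⟨b, hb, hbd⟩ := rolle h hwk hu
        have := hleast w hw (b - k * T) (by linarith [hb.1]) (by rw [hp.sub_int_mul_eq, hbd])
        linarith [hb.2]
    have h1 : toIcoMod hT 0 u = u := (toIcoMod_eq_self hT).2 (by simpa using hu0)
    have h2 : toIcoMod hT 0 w = w := (toIcoMod_eq_self hT).2 (by simpa using hw0)
    rw [← h1, heq, ← zsmul_eq_mul, toIcoMod_add_zsmul, h2]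

/-- The reverse inequality is the same one for `-f`, which exchanges the levels and turns minima
into maxima. -/
theorem encard_lower_eq_encard_upper (hf : Continuous f) (hT : 0 < T)
    (hp : Function.Periodic f T) (hcd : c < d) (hfd : ∀ t, f t ≤ d) (hfc : ∀ t, c ≤ f t)
    (hmax : ∀ t, c < f t → f t < d → ¬ IsLocalMax f t)
    (hmin : ∀ t, c < f t → f t < d → ¬ IsLocalMin f t)
    (hnc : ∀ u w, u < w → ∃ t ∈ Set.Ioo u w, f t ≠ c)
    (hnd : ∀ u w, u < w → ∃ t ∈ Set.Ioo u w, f t ≠ d) :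
    {t ∈ Set.Ico 0 T | f t = c}.encard = {t ∈ Set.Ico 0 T | f t = d}.encard := by
  refine le_antisymm (encard_lower_le_encard_upper hf hT hp hcd hfd hfc hmax hnc) ?_
  have h := encard_lower_le_encard_upper (f := fun t => -f t) (c := -d) (d := -c) hf.neg hT
    (fun t => by simp only [hp t]) (neg_lt_neg hcd) (fun t => neg_le_neg (hfc t))
    (fun t => neg_le_neg (hfd t))
    (fun t h1 h2 h3 => hmin t (neg_lt_neg_iff.1 h2) (neg_lt_neg_iff.1 h1) (by simpa using h3.neg))
    (fun u w huw => by simpa using hnd u w huw)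
  simpa using h

/-- A function with values in `[c, d]` is continuous if it passes each level strictly between as a
continuous function changes its sign. -/
theorem continuous_of_level_sets (hfd : ∀ t, f t ≤ d) (hfc : ∀ t, c ≤ f t)
    (h1 : ∀ z ∈ Set.Ioo c d, IsOpen {t | f t < z}) (h2 : ∀ z ∈ Set.Ioo c d, IsOpen {t | z < f t}) :
    Continuous f := by
  refine continuous_iff_continuousAt.2 fun t => tendsto_order.2 ⟨fun r hr => ?_, fun r hr => ?_⟩
  · rcases lt_or_ge r c with hrc | hrc
    · exact Filter.Eventually.of_forall fun s => hrc.trans_le (hfc s)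
    · obtain ⟨z, hrz, hz⟩ := exists_between hr
      exact Filter.mem_of_superset
        ((h2 z ⟨hrc.trans_lt hrz, hz.trans_le (hfd t)⟩).mem_nhds hz) fun s hs => hrz.trans hs
  · rcases lt_or_ge d r with hrd | hrd
    · exact Filter.Eventually.of_forall fun s => (hfd s).trans_lt hrd
    · obtain ⟨z, hz, hzr⟩ := exists_between hr
      exact Filter.mem_of_superset
        ((h1 z ⟨(hfc t).trans_lt hz, hzr.trans_le hrd⟩).mem_nhds hz) fun s hs => lt_trans hs hzr

end PeriodicFunctions

/-- The number of sign changes of a periodic sequence along a period is even, if the sequence changes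
its sign at each of its zeros. -/
theorem even_card_sign_changes {y : ℤ → ℝ} {m : ℕ} (hp : ∀ k, y (k + m) = y k)
    (hy : ∀ k, y k = 0 → y (k - 1) * y (k + 1) < 0) :
    Even ((Finset.range m).filter fun k : ℕ => y k = 0 ∨ y k * y (k + 1) < 0).card := by
  classical
  -- Each zero takes the preceding value, so a change of sign through a zero at `k` is recorded
  -- between `k` and `k + 1` only.
  let e : ℤ → ℝ := fun k => if y k = 0 then y (k - 1) else y k
  have he : ∀ k, e k ≠ 0 := fun k => by
    by_cases h : y k = 0
    · simpa [e, h] using left_ne_zero_of_mul (hy k h).ne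
    · simp [e, h]
  have hchange : ∀ k, (y k = 0 ∨ y k * y (k + 1) < 0) → e k * e (k + 1) < 0 := fun k hk => by
    by_cases h : y k = 0
    · have := right_ne_zero_of_mul (hy k h).ne
      simpa [e, h, this] using hy k h
    · have hk' := hk.resolve_left h
      have := right_ne_zero_of_mul hk'.ne
      simpa [e, h, this] using hk'
  have hkeep : ∀ k, ¬ (y k = 0 ∨ y k * y (k + 1) < 0) → 0 < e k * e (k + 1) := fun k hk => by
    push Not at hk
    by_cases h : y (k + 1) = 0
    · simp [e, h, hk.1]
    · have := lt_of_le_of_ne hk.2 (mul_ne_zero hk.1 h).symm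
      simpa [e, h, hk.1] using this
  -- The parity of the number of changes is the sign of `e 0 * e r`, which is positive at `r = m` by
  -- periodicity.
  have hind : ∀ r : ℕ, 0 < (-1 : ℝ) ^ ((Finset.range r).filter
      fun k : ℕ => y k = 0 ∨ y k * y (k + 1) < 0).card * (e 0 * e r) := by
    intro r
    induction r with
    | zero => simpa using he 0
    | succ r ih =>
      have hpos := mul_self_pos.2 (he r)
      rw [Finset.range_add_one, Finset.filter_insert]
      by_cases h : y r = 0 ∨ y r * y (r + 1) < 0
      · rw [if_pos h, Finset.card_insert_of_notMem (by simp), pow_succ]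
        have := mul_pos_of_neg_of_neg (mul_neg_of_pos_of_neg ih (hchange r h)) neg_one_lt_zero
        refine pos_of_mul_pos_right (a := e r * e r) ?_ hpos.le
        push_cast
        linarith
      · rw [if_neg h]
        have := mul_pos ih (hkeep r h)
        refine pos_of_mul_pos_right (a := e r * e r) ?_ hpos.le
        push_cast
        linarith
  have hm := hind m
  have hem : e m = e 0 := by
    have h1 := hp 0
    have h2 := hp (-1)
    rw [zero_add] at h1
    rw [neg_add_eq_sub] at h2
    simp only [e, h1, h2, zero_sub]
  rw [hem] at hm
  by_contra hodd
  rw [(Nat.not_even_iff_odd.1 hodd).neg_one_pow] at hm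
  nlinarith [mul_self_nonneg (e 0)]

end EllipsoidBilliard

/-! ### The trajectory as a continuous path, and its crossings of confocal quadrics. -/

namespace EllipsoidBilliard

open Polynomial

noncomputable section

theorem continuous_eval_confocalPoly {n : ℕ} {a : Fin (n + 1) → ℝ} (z : ℝ) :
    Continuous fun x : EuclideanSpace ℝ (Fin (n + 1)) => (confocalPoly a x).eval z := by
  simp only [confocalPoly, eval_add, eval_bilinPoly]
  fun_prop

theorem sum_sq_div_add_smul {n : ℕ} {a : Fin (n + 1) → ℝ} (x v : EuclideanSpace ℝ (Fin (n + 1)))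
    (t : ℝ) : ∑ i, (x + t • v) i ^ 2 / a i =
      ∑ i, x i ^ 2 / a i + t * (2 * ∑ i, x i * v i / a i + t * ∑ i, v i ^ 2 / a i) := by
  simp only [Finset.mul_sum, ← Finset.sum_add_distrib]
  refine Finset.sum_congr rfl fun i _ => ?_
  simp only [PiLp.add_apply, PiLp.smul_apply, smul_eq_mul]
  ring

theorem sum_sq_div_eq_one_iff {n : ℕ} {a : Fin (n + 1) → ℝ} {l : Fin n → ℝ} (h : Interlaced a l)
    (x : EuclideanSpace ℝ (Fin (n + 1))) :
    ∑ i, x i ^ 2 / a i = 1 ↔ (confocalPoly a x).eval 0 = 0 := by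
  have h0 := eval_confocalPoly_zero h x
  have hpos : 0 < ∏ i, a i := Finset.prod_pos fun i _ =>
    h.axis_pos.trans_le (h.axis_mono.monotone (Fin.zero_le i))
  have hsgn : (-1 : ℝ) ^ (n + 1) ≠ 0 := pow_ne_zero _ (by norm_num)
  constructor
  · intro e
    rw [e, sub_self, mul_zero] at h0
    exact (mul_eq_zero.1 h0).resolve_left hsgn
  · intro e
    rw [e, mul_zero] at h0
    have := (mul_eq_zero.1 h0.symm).resolve_left hpos.ne'
    linarith

/-- The reflection changes only the part of the velocity conjugate to all confocal quadrics through
the impact point, other than the ellipsoid. -/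
theorem bilinPoly_reflectAt {n : ℕ} {a : Fin (n + 1) → ℝ} (ha : ∀ i, a i ≠ 0)
    {x : EuclideanSpace ℝ (Fin (n + 1))} (hx : ∑ i, x i ^ 2 / a i = 1)
    (p : EuclideanSpace ℝ (Fin (n + 1))) {z : ℝ} (hz : z ≠ 0)
    (h0 : (confocalPoly a x).eval z = 0) :
    (bilinPoly a x (reflectAt a x p)).eval z = (bilinPoly a x p).eval z := by
  have hn : (bilinPoly a x (normalVector a x)).eval z = 0 := by
    -- Writing `D` as `D ∑ x i ^ 2 / a i` and using `D = (z - a i) * cofactor a i` in each term,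
    -- `P(z)` becomes `z` times the left side.
    apply mul_left_cancel₀ hz
    rw [mul_zero, ← h0, confocalPoly, eval_add, ← mul_one (eval z (axesPoly a)), ← hx,
      eval_bilinPoly, eval_bilinPoly, Finset.mul_sum, Finset.mul_sum, ← Finset.sum_add_distrib]
    refine Finset.sum_congr rfl fun i _ => ?_
    have hi := ha i
    rw [← mul_cofactor i]
    simp only [normalVector, eval_mul, eval_sub, eval_X, eval_C]
    field_simp
    ring
  rw [reflectAt, sub_eq_add_neg, ← neg_smul, bilinPoly_comm, bilinPoly_add_smul,
    bilinPoly_comm (y := x), bilinPoly_comm (y := x)]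
  simp [hn]

namespace Trajectory

variable {n : ℕ} {a : Fin (n + 1) → ℝ} {l : Fin n → ℝ} (γ : Trajectory a)

/-- The length of the segment from `q k` to `q (k + 1)`. -/
def len (k : ℤ) : ℝ := (γ.q_step k).choose

theorem len_pos (k : ℤ) : 0 < γ.len k := (γ.q_step k).choose_spec.1

theorem q_succ (k : ℤ) : γ.q (k + 1) = γ.q k + γ.len k • γ.p (k + 1) :=
  (γ.q_step k).choose_spec.2

theorem lineMap_eq (k : ℤ) (t : ℝ) : AffineMap.lineMap (γ.q k) (γ.q (k + 1)) t =
    γ.q k + (t * γ.len k) • γ.p (k + 1) := by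
  rw [q_succ, AffineMap.lineMap_apply, vsub_eq_sub, add_sub_cancel_left, vadd_eq_add,
    add_comm (_ • _), smul_smul]

/-- The position at time `t`, if each segment is run through in a unit of time. -/
def path (t : ℝ) : EuclideanSpace ℝ (Fin (n + 1)) :=
  AffineMap.lineMap (γ.q ⌊t⌋) (γ.q (⌊t⌋ + 1)) (Int.fract t)

theorem path_eq {k : ℤ} {t : ℝ} (ht : t ∈ Set.Icc (k : ℝ) (k + 1)) :
    γ.path t = γ.q k + ((t - k) * γ.len k) • γ.p (k + 1) := by
  rcases ht.2.eq_or_lt with e | h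
  · have h1 : ⌊t⌋ = k + 1 := by rw [e]; simp
    have h2 : Int.fract t = 0 := by rw [e]; simp
    rw [path, h1, h2, AffineMap.lineMap_apply_zero, e, add_sub_cancel_left, one_mul, ← q_succ]
  · have h1 : ⌊t⌋ = k := Int.floor_eq_iff.2 ⟨ht.1, h⟩
    rw [path, lineMap_eq, Int.fract, h1]

theorem path_eq_add {k : ℤ} {t r : ℝ} (ht : t ∈ Set.Icc (k : ℝ) (k + 1))
    (hr : r ∈ Set.Icc (k : ℝ) (k + 1)) :
    γ.path r = γ.path t + ((r - t) * γ.len k) • γ.p (k + 1) := by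
  rw [γ.path_eq ht, γ.path_eq hr, add_assoc, ← add_smul]
  congr 2
  ring

theorem mem_Icc_floor (t : ℝ) : t ∈ Set.Icc (⌊t⌋ : ℝ) (⌊t⌋ + 1) :=
  ⟨Int.floor_le t, (Int.lt_floor_add_one t).le⟩

/-- `⌈t⌉ - 1` is the index of the segment just before time `t`, and `⌊t⌋` that of the segment just
after; they differ only at bounces. -/
theorem lt_ceil_sub_one (t : ℝ) : ((⌈t⌉ - 1 : ℤ) : ℝ) < t := by
  push_cast
  linarith [Int.ceil_lt_add_one t]

theorem mem_Icc_ceil (t : ℝ) : t ∈ Set.Icc ((⌈t⌉ - 1 : ℤ) : ℝ) ((⌈t⌉ - 1 : ℤ) + 1) := by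
  refine ⟨(lt_ceil_sub_one t).le, ?_⟩
  push_cast
  linarith [Int.le_ceil t]

theorem continuousOn_path (k : ℤ) : ContinuousOn γ.path (Set.Icc (k : ℝ) (k + 1)) := by
  refine ContinuousOn.congr (f := fun t : ℝ => γ.q k + ((t - k) * γ.len k) • γ.p (k + 1)) ?_
    fun t ht => γ.path_eq ht
  fun_prop

theorem eventually_right (t : ℝ) :
    ∀ᶠ r in nhdsWithin t (Set.Ici t), r ∈ Set.Icc (⌊t⌋ : ℝ) (⌊t⌋ + 1) :=
  Filter.mem_of_superset (Icc_mem_nhdsGE (Int.lt_floor_add_one t))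
    (Set.Icc_subset_Icc_left (Int.floor_le t))

theorem eventually_left (t : ℝ) :
    ∀ᶠ r in nhdsWithin t (Set.Iic t), r ∈ Set.Icc ((⌈t⌉ - 1 : ℤ) : ℝ) ((⌈t⌉ - 1 : ℤ) + 1) :=
  Filter.mem_of_superset (Icc_mem_nhdsLE (lt_ceil_sub_one t))
    (Set.Icc_subset_Icc_right (mem_Icc_ceil t).2)

theorem continuous_path : Continuous γ.path := by
  refine continuous_iff_continuousAt.2 fun t => continuousAt_iff_continuous_left_right.2 ⟨?_, ?_⟩
  · exact (γ.continuousOn_path _ t (mem_Icc_ceil t)).mono_of_mem_nhdsWithin (eventually_left t)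
  · exact (γ.continuousOn_path _ t (mem_Icc_floor t)).mono_of_mem_nhdsWithin (eventually_right t)

variable {γ}

theorem sum_sq_q (h : Interlaced a l) (k : ℤ) : ∑ i, γ.q k i ^ 2 / a i = 1 :=
  (sum_sq_div_eq_one_iff h _).2 ((mem_confocalQuadric_iff h.axis_mono).1 (γ.q_mem k))

/-- The quadratic form of the ellipsoid along a segment. -/
theorem sum_sq_segment (h : Interlaced a l) (k : ℤ) :
    ∃ r : ℝ, 0 < r ∧ ∀ t : ℝ, ∑ i, (γ.q k + (t * γ.len k) • γ.p (k + 1)) i ^ 2 / a i =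
      1 - r * (t * (1 - t)) := by
  have hpos : ∀ i, 0 < a i := fun i =>
    h.axis_pos.trans_le (h.axis_mono.monotone (Fin.zero_le i))
  have hv : 0 < ∑ i, γ.p (k + 1) i ^ 2 / a i := by
    have hne : γ.p (k + 1) ≠ 0 := fun e => by
      have := γ.norm_p (k + 1)
      rw [e, norm_zero] at this
      exact zero_ne_one this
    obtain ⟨i, hi⟩ : ∃ i, γ.p (k + 1) i ≠ 0 := by
      by_contra! hall
      exact hne (PiLp.ext hall)
    exact Finset.sum_pos' (fun i _ => div_nonneg (sq_nonneg _) (hpos i).le)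
      ⟨i, Finset.mem_univ i, div_pos (by positivity) (hpos i)⟩
  have hlen := γ.len_pos k
  refine ⟨γ.len k ^ 2 * ∑ i, γ.p (k + 1) i ^ 2 / a i, by positivity, fun t => ?_⟩
  have h1 := sum_sq_q (γ := γ) h (k + 1)
  rw [γ.q_succ, sum_sq_div_add_smul, sum_sq_q h] at h1
  -- Both ends of the chord lie on the ellipsoid, so the roots of its quadratic are `0` and `len k`.
  have h2 : 2 * ∑ i, γ.q k i * γ.p (k + 1) i / a i +
      γ.len k * ∑ i, γ.p (k + 1) i ^ 2 / a i = 0 :=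
    (mul_eq_zero.1 (by linarith : γ.len k * _ = 0)).resolve_left hlen.ne'
  rw [sum_sq_div_add_smul, sum_sq_q h]
  linear_combination (t * γ.len k) * h2

theorem sum_sq_path_le (h : Interlaced a l) (t : ℝ) : ∑ i, γ.path t i ^ 2 / a i ≤ 1 := by
  obtain ⟨r, hr, hs⟩ := sum_sq_segment (γ := γ) h ⌊t⌋
  have hm := mem_Icc_floor t
  rw [γ.path_eq hm, hs]
  have : 0 ≤ r * ((t - ⌊t⌋) * (1 - (t - ⌊t⌋))) :=
    mul_nonneg hr.le (mul_nonneg (by linarith [hm.1]) (by linarith [hm.2]))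
  linarith

theorem causticIdentity_q (h : Interlaced a l) (hc : γ.HasCaustics l) (k : ℤ) :
    CausticIdentity a l (γ.q k) (γ.p (k + 1)) :=
  causticIdentity_of_tangentTo h.injective (γ.norm_p _) (hc k)

theorem causticIdentity_path (h : Interlaced a l) (hc : γ.HasCaustics l) {k : ℤ} {t : ℝ}
    (ht : t ∈ Set.Icc (k : ℝ) (k + 1)) : CausticIdentity a l (γ.path t) (γ.p (k + 1)) := by
  rw [γ.path_eq ht]
  exact (causticIdentity_q h hc k).add_smul _

/-- A segment meets each singular quadric at most once. -/
theorem segment_unique (h : Interlaced a l) (hc : γ.HasCaustics l) {z : ℝ}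
    (hz : z = 0 ∨ z ∈ Set.range a ∪ Set.range l) (k : ℤ) {t r : ℝ} (ht : t ∈ Set.Ico (0 : ℝ) 1)
    (hr : r ∈ Set.Ico (0 : ℝ) 1)
    (ht0 : (confocalPoly a (γ.q k + (t * γ.len k) • γ.p (k + 1))).eval z = 0)
    (hr0 : (confocalPoly a (γ.q k + (r * γ.len k) • γ.p (k + 1))).eval z = 0) : t = r := by
  rcases hz with rfl | hz
  · obtain ⟨c, hc, hs⟩ := sum_sq_segment (γ := γ) h k
    have key : ∀ t ∈ Set.Ico (0 : ℝ) 1,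
        (confocalPoly a (γ.q k + (t * γ.len k) • γ.p (k + 1))).eval 0 = 0 → t = 0 := by
      intro t ht h0
      rw [← sum_sq_div_eq_one_iff h, hs] at h0
      have h1 : c * (t * (1 - t)) = 0 := by linarith
      have h2 := (mul_eq_zero.1 h1).resolve_left hc.ne'
      exact (mul_eq_zero.1 h2).resolve_right (by linarith [ht.2])
    rw [key t ht ht0, key r hr hr0]
  · have hid := causticIdentity_q h hc k
    have he := hid.eval_eq z
    have hn := hid.not_all_zero h.injective z
    have hprod : (∏ i, (z - a i)) * ∏ i, (z - l i) = 0 := by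
      rcases hz with ⟨i, rfl⟩ | ⟨i, rfl⟩
      · rw [Finset.prod_eq_zero (Finset.mem_univ i) (sub_self _), zero_mul]
      · rw [mul_comm, Finset.prod_eq_zero (Finset.mem_univ i) (sub_self _), zero_mul]
    rw [hprod] at he
    rw [eval_confocalPoly_add_smul] at ht0 hr0
    generalize (confocalPoly a (γ.q k)).eval z = P at *
    generalize (bilinPoly a (γ.q k) (γ.p (k + 1))).eval z = W at *
    generalize (bilinPoly a (γ.p (k + 1)) (γ.p (k + 1))).eval z = V at *
    have hlen := γ.len_pos k
    generalize γ.len k = s at *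
    by_contra hne
    have h1 : 2 * W + (t * s + r * s) * V = 0 := by
      have : (t * s - r * s) * (2 * W + (t * s + r * s) * V) = 0 := by linear_combination ht0 - hr0
      refine (mul_eq_zero.1 this).resolve_left ?_
      rw [← sub_mul]
      exact mul_ne_zero (sub_ne_zero.2 hne) hlen.ne'
    have hP : P = (t * s) * (r * s) * V := by linear_combination ht0 - t * s * h1
    have hW : W = -((t * s + r * s) * V) / 2 := by linear_combination h1 / 2
    -- Two distinct zeros make the discriminant a nonzero multiple of `V²`, but it vanishes; the
    -- quadratic would then be identically zero.
    have hV : V = 0 := by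
      rw [hP, hW] at he
      have : (V * ((t - r) * s)) ^ 2 = 0 := by linear_combination -4 * he
      exact (mul_eq_zero.1 (pow_eq_zero_iff two_ne_zero |>.1 this)).resolve_right
        (mul_ne_zero (sub_ne_zero.2 hne) hlen.ne')
    exact hn ⟨hV, by rw [hW, hV]; ring, by rw [hP, hV]; ring⟩

theorem exists_eval_path_ne_zero (h : Interlaced a l) (hc : γ.HasCaustics l) {z : ℝ}
    (hz : z = 0 ∨ z ∈ Set.range a ∪ Set.range l) {u w : ℝ} (huw : u < w) :
    ∃ t ∈ Set.Ioo u w, (confocalPoly a (γ.path t)).eval z ≠ 0 := by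
  by_contra! hall
  have hu := Int.floor_le u
  have hr : u < min w (⌊u⌋ + 1) := lt_min huw (Int.lt_floor_add_one u)
  obtain ⟨t, hut, ht⟩ := exists_between hr
  obtain ⟨r, htr, hr⟩ := exists_between ht
  rw [lt_min_iff] at ht hr
  have key : ∀ s : ℝ, u < s → s < w → s < ⌊u⌋ + 1 → (s - ⌊u⌋ ∈ Set.Ico (0 : ℝ) 1) ∧
      (confocalPoly a (γ.q ⌊u⌋ + ((s - ⌊u⌋) * γ.len ⌊u⌋) • γ.p (⌊u⌋ + 1))).eval z = 0 := by
    intro s h1 h2 h3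
    refine ⟨⟨by linarith, by linarith⟩, ?_⟩
    rw [← γ.path_eq ⟨by linarith, h3.le⟩]
    exact hall s ⟨h1, h2⟩
  obtain ⟨ht1, ht2⟩ := key t hut ht.1 ht.2
  obtain ⟨hr1, hr2⟩ := key r (hut.trans htr) hr.1 hr.2
  have := segment_unique h hc hz ⌊u⌋ ht1 hr1 ht2 hr2
  linarith

/-- Strictly inside an interval of oscillation, the trajectory crosses the confocal quadric. -/
theorem crossing (h : Interlaced a l) (hc : γ.HasCaustics l) {t z : ℝ} {j : Fin (n + 1)}
    (hz : z ∈ Set.Ioo (lowerEnd a l j) (upperEnd a l j))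
    (h0 : (confocalPoly a (γ.path t)).eval z = 0) :
    ∃ W : ℝ,
      (∀ᶠ r in nhdsWithin t (Set.Ioi t), 0 < W * (confocalPoly a (γ.path r)).eval z) ∧
      ∀ᶠ r in nhdsWithin t (Set.Iio t), W * (confocalPoly a (γ.path r)).eval z < 0 := by
  have hz0 : z ≠ 0 := ((h.lowerEnd_nonneg j).trans_lt hz.1).ne'
  have ha : ∀ i, a i ≠ 0 := fun i =>
    (h.axis_pos.trans_le (h.axis_mono.monotone (Fin.zero_le i))).ne'
  -- The velocities before and after `t` differ only at a bounce, and there the reflection preserves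
  -- `W`.
  have hW : (bilinPoly a (γ.path t) (γ.p (⌈t⌉ - 1 + 1))).eval z =
      (bilinPoly a (γ.path t) (γ.p (⌊t⌋ + 1))).eval z := by
    rw [sub_add_cancel]
    by_cases hint : (⌊t⌋ : ℝ) = t
    · have hceil : ⌈t⌉ = ⌊t⌋ := by
        conv_lhs => rw [← hint]
        exact Int.ceil_intCast _
      have hq : γ.path t = γ.q ⌊t⌋ := by
        rw [γ.path_eq (mem_Icc_floor t), hint, sub_self, zero_mul, zero_smul, add_zero]
      rw [hceil, γ.p_step, hq]
      rw [hq] at h0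
      exact (bilinPoly_reflectAt ha (sum_sq_q h _) _ hz0 h0).symm
    · have hceil : ⌈t⌉ = ⌊t⌋ + 1 := by
        rw [Int.ceil_eq_iff]
        push_cast
        refine ⟨?_, (Int.lt_floor_add_one t).le⟩
        have := lt_of_le_of_ne (Int.floor_le t) hint
        linarith
      rw [hceil]
  have hpos : 0 < (bilinPoly a (γ.path t) (γ.p (⌊t⌋ + 1))).eval z ^ 2 := by
    have h1 := (causticIdentity_path h hc (mem_Icc_floor t)).eval_eq z
    have h2 := h.prod_factors_neg hz
    rw [← h1, h0] at h2
    linarith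
  set W := (bilinPoly a (γ.path t) (γ.p (⌊t⌋ + 1))).eval z with hWdef
  -- On either side of `t` the value is `(r - t) s (2 W + (r - t) s V)`, where `s` is the length of
  -- the segment; multiplied by `W`, the last factor is positive near `t`.
  have hnear : ∀ s V : ℝ, ∀ᶠ r in nhds t, 0 < 2 * W ^ 2 + (r - t) * s * (W * V) := fun s V => by
    have hcont : Continuous fun r : ℝ => 2 * W ^ 2 + (r - t) * s * (W * V) := by fun_prop
    refine hcont.continuousAt.eventually (lt_mem_nhds ?_)
    simp only [sub_self, zero_mul, add_zero]
    linarith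
  refine ⟨W, ?_, ?_⟩
  · filter_upwards [nhdsWithin_mono t Set.Ioi_subset_Ici_self (eventually_right t),
      nhdsWithin_le_nhds (hnear (γ.len ⌊t⌋)
        ((bilinPoly a (γ.p (⌊t⌋ + 1)) (γ.p (⌊t⌋ + 1))).eval z)), self_mem_nhdsWithin]
      with r hr1 hr2 hr3
    rw [γ.path_eq_add (mem_Icc_floor t) hr1, eval_confocalPoly_add_smul, h0, ← hWdef]
    have := mul_pos (mul_pos (sub_pos.2 hr3) (γ.len_pos ⌊t⌋)) hr2
    linarith
  · filter_upwards [nhdsWithin_mono t Set.Iio_subset_Iic_self (eventually_left t),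
      nhdsWithin_le_nhds (hnear (γ.len (⌈t⌉ - 1))
        ((bilinPoly a (γ.p (⌈t⌉ - 1 + 1)) (γ.p (⌈t⌉ - 1 + 1))).eval z)), self_mem_nhdsWithin]
      with r hr1 hr2 hr3
    rw [γ.path_eq_add (mem_Icc_ceil t) hr1, eval_confocalPoly_add_smul, h0, hW]
    have := mul_neg_of_neg_of_pos (mul_neg_of_neg_of_pos (sub_neg.2 hr3) (γ.len_pos (⌈t⌉ - 1))) hr2
    linarith

/-- Both signs occur near a crossing. The two signs of `e` will exclude local maxima and local
minima of the elliptic coordinate. -/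
theorem not_eventually_sign (h : Interlaced a l) (hc : γ.HasCaustics l) {t z : ℝ} {j : Fin (n + 1)}
    (hz : z ∈ Set.Ioo (lowerEnd a l j) (upperEnd a l j))
    (h0 : (confocalPoly a (γ.path t)).eval z = 0) (e : ℝ) (he : e ≠ 0) :
    ¬ ∀ᶠ r in nhds t, 0 ≤ e * (confocalPoly a (γ.path r)).eval z := by
  intro hev
  obtain ⟨W, hright, hleft⟩ := crossing h hc hz h0
  obtain ⟨r, hr1, hr2⟩ := (hright.and (nhdsWithin_le_nhds hev)).exists
  obtain ⟨s, hs1, hs2⟩ := (hleft.and (nhdsWithin_le_nhds hev)).exists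
  generalize (confocalPoly a (γ.path r)).eval z = P at hr1 hr2
  generalize (confocalPoly a (γ.path s)).eval z = R at hs1 hs2
  have hP : P ≠ 0 := right_ne_zero_of_mul hr1.ne'
  have hR : R ≠ 0 := right_ne_zero_of_mul hs1.ne
  have hr3 := lt_of_le_of_ne hr2 (mul_ne_zero he hP).symm
  have hs3 := lt_of_le_of_ne hs2 (mul_ne_zero he hR).symm
  nlinarith [mul_pos hr1 hr3, mul_pos (neg_pos.2 hs1) hs3, mul_pos (sq_pos_of_ne_zero hP)
    (sq_pos_of_ne_zero hR), mul_pos (mul_pos hr1 hr3) (mul_pos (neg_pos.2 hs1) hs3),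
    sq_nonneg (W * e * P * R)]

theorem periodic_path {m : ℕ} (hm : ∀ i : ℤ, γ.q (i + m) = γ.q i) :
    Function.Periodic γ.path (m : ℝ) := by
  intro t
  rw [path, path, Int.floor_add_natCast, Int.fract_add_natCast, hm,
    show ⌊t⌋ + (m : ℤ) + 1 = ⌊t⌋ + 1 + m by ring, hm]

/-- In each interval of oscillation, both ends are attained equally often along a period. -/
theorem encard_path_ends (h : Interlaced a l) (hc : γ.HasCaustics l) {m : ℕ} (hm0 : 0 < m)
    (hm : ∀ i : ℤ, γ.q (i + m) = γ.q i) (j : Fin (n + 1)) :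
    {t ∈ Set.Ico (0 : ℝ) m | (confocalPoly a (γ.path t)).eval (lowerEnd a l j) = 0}.encard =
    {t ∈ Set.Ico (0 : ℝ) m | (confocalPoly a (γ.path t)).eval (upperEnd a l j) = 0}.encard := by
  choose μ hμ hP using fun t => exists_elliptic_coordinates h
    (causticIdentity_path h hc (mem_Icc_floor t)) (sum_sq_path_le (γ := γ) h t)
  have hlu := h.lowerEnd_lt_upperEnd j
  have hzero : ∀ {t z}, z ∈ Set.Icc (lowerEnd a l j) (upperEnd a l j) →
      ((confocalPoly a (γ.path t)).eval z = 0 ↔ μ t j = z) := fun hz =>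
    eval_confocalPoly_eq_zero_iff h (hμ _) (hP _) hz
  have hsign := fun {z} (hz : z ∈ Set.Icc (lowerEnd a l j) (upperEnd a l j)) t =>
    eval_confocalPoly_sign h (hμ t) (hP t) hz
  have hcont : ∀ z : ℝ, Continuous fun t =>
      (-1 : ℝ) ^ (n - (j : ℕ)) * (confocalPoly a (γ.path t)).eval z := fun z =>
    continuous_const.mul ((continuous_eval_confocalPoly z).comp γ.continuous_path)
  have hl := Set.left_mem_Icc.2 hlu.le
  have hu := Set.right_mem_Icc.2 hlu.le
  have hlz : lowerEnd a l j = 0 ∨ lowerEnd a l j ∈ Set.range a ∪ Set.range l := by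
    refine Fin.cases (Or.inl rfl) (fun i => Or.inr (lowerEnd_succ_mem i)) j
  simp only [hzero hl, hzero hu]
  have hsgn : (-1 : ℝ) ^ (n - (j : ℕ)) ≠ 0 := pow_ne_zero _ (by norm_num)
  refine encard_lower_eq_encard_upper (f := fun t => μ t j) ?_ (by exact_mod_cast hm0) ?_ hlu
    (fun t => (hμ t j).2) (fun t => (hμ t j).1) ?_ ?_ ?_ ?_
  -- The coordinates were chosen at each time separately; continuity is recovered because `μ t j <
  -- z` and `μ t j > z` are sign conditions on a continuous function.
  · refine continuous_of_level_sets (fun t => (hμ t j).2) (fun t => (hμ t j).1) ?_ ?_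
    · intro z hz
      convert isOpen_lt (continuous_const (y := (0 : ℝ))) (hcont z) using 1
      ext t
      obtain ⟨r, hr, e⟩ := hsign (Set.Ioo_subset_Icc_self hz) t
      simp only [Set.mem_ofPred_eq, e, mul_pos_iff_of_pos_left hr, sub_pos]
    · intro z hz
      convert isOpen_lt (hcont z) (continuous_const (y := (0 : ℝ))) using 1
      ext t
      obtain ⟨r, hr, e⟩ := hsign (Set.Ioo_subset_Icc_self hz) t
      rw [Set.mem_ofPred_eq, Set.mem_ofPred_eq, e, ← neg_pos, ← mul_neg, mul_pos_iff_of_pos_left hr,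
        neg_sub, sub_pos]
  · intro t
    refine (hzero (hμ t j)).1 ?_
    rw [periodic_path hm]
    exact (hzero (hμ t j)).2 rfl
  · intro t h1 h2 hmax
    refine not_eventually_sign h hc ⟨h1, h2⟩ ((hzero (hμ t j)).2 rfl) _ hsgn
      (hmax.mono fun r hr => ?_)
    obtain ⟨s, hs, e⟩ := hsign (hμ t j) r
    rw [e]
    exact mul_nonneg hs.le (sub_nonneg.2 hr)
  · intro t h1 h2 hmin
    refine not_eventually_sign h hc ⟨h1, h2⟩ ((hzero (hμ t j)).2 rfl) _ (neg_ne_zero.2 hsgn)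
      (hmin.mono fun r hr => ?_)
    obtain ⟨s, hs, e⟩ := hsign (hμ t j) r
    rw [neg_mul, e]
    exact neg_nonneg.2 (mul_nonpos_of_nonneg_of_nonpos hs.le (sub_nonpos.2 hr))
  · intro u w huw
    obtain ⟨t, ht, hne⟩ := exists_eval_path_ne_zero h hc hlz huw
    exact ⟨t, ht, fun e => hne ((hzero hl).2 e)⟩
  · intro u w huw
    obtain ⟨t, ht, hne⟩ := exists_eval_path_ne_zero h hc (Or.inr (upperEnd_mem j)) huw
    exact ⟨t, ht, fun e => hne ((hzero hu).2 e)⟩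

end Trajectory

end

end EllipsoidBilliard

/-! ### Counting visits: existence and parity of winding numbers. -/

namespace EllipsoidBilliard

open Polynomial

section WindingNumbers

variable {n : ℕ} {a : Fin (n + 1) → ℝ} {l : Fin n → ℝ} {γ : Trajectory a}

namespace Trajectory

theorem path_natCast_add (k : ℕ) {t : ℝ} (ht : t ∈ Set.Ico (0 : ℝ) 1) :
    γ.path (k + t) = AffineMap.lineMap (γ.q k) (γ.q (k + 1)) t := by
  have h1 : ⌊(k : ℝ) + t⌋ = k := Int.floor_eq_iff.2 ⟨by simpa using ht.1, by simpa using ht.2⟩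
  have h2 : Int.fract ((k : ℝ) + t) = t := by simp [Int.fract, h1]
  rw [path, h1, h2]

/-- The pair `(k, t)` corresponds to the time `k + t`. -/
theorem encard_visits (ha : StrictMono a) (m : ℕ) (z : ℝ) : (γ.visits m z).encard =
    {t ∈ Set.Ico (0 : ℝ) m | (confocalPoly a (γ.path t)).eval z = 0}.encard := by
  have hinj : Set.InjOn (fun s : ℕ × ℝ => (s.1 : ℝ) + s.2) (γ.visits m z) := by
    rintro ⟨k, t⟩ ⟨-, ht, -⟩ ⟨k', t'⟩ ⟨-, ht', -⟩ h
    simp only at h ht ht'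
    have hk : k = k' := by
      have h1 : (k : ℝ) < k' + 1 := by linarith [ht.1, ht'.2]
      have h2 : (k' : ℝ) < k + 1 := by linarith [ht'.1, ht.2]
      have h1' : k < k' + 1 := by exact_mod_cast h1
      have h2' : k' < k + 1 := by exact_mod_cast h2
      omega
    subst hk
    rw [add_left_cancel h]
  rw [← hinj.encard_image]
  congr 1
  ext t
  constructor
  · rintro ⟨⟨k, r⟩, ⟨hk, hr, hv⟩, rfl⟩
    have hk' : (k : ℝ) + 1 ≤ m := by exact_mod_cast hk
    refine ⟨⟨add_nonneg k.cast_nonneg hr.1, ?_⟩, ?_⟩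
    · have := hr.2
      simp only at this ⊢
      linarith
    · rw [path_natCast_add k hr]
      exact (mem_confocalQuadric_iff ha).1 hv
  · rintro ⟨ht, h0⟩
    obtain ⟨k, hk⟩ := Int.eq_ofNat_of_zero_le (Int.floor_nonneg.2 ht.1)
    have hkt : (k : ℝ) + Int.fract t = t := by
      rw [← Int.floor_add_fract t, hk]
      simp
    have hr : Int.fract t ∈ Set.Ico (0 : ℝ) 1 := ⟨Int.fract_nonneg t, Int.fract_lt_one t⟩
    refine ⟨(k, Int.fract t), ⟨?_, hr, ?_⟩, hkt⟩
    · have : (k : ℝ) < m := by linarith [hr.1, ht.2]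
      exact_mod_cast this
    · rw [mem_confocalQuadric_iff ha]
      simp only
      rw [← path_natCast_add k hr, hkt]
      exact h0

theorem injOn_fst_visits (h : Interlaced a l) (hc : γ.HasCaustics l) (m : ℕ) {z : ℝ}
    (hz : z = 0 ∨ z ∈ Set.range a ∪ Set.range l) : Set.InjOn Prod.fst (γ.visits m z) := by
  rintro ⟨k, t⟩ ⟨-, ht, ht0⟩ ⟨k', t'⟩ ⟨-, ht', ht0'⟩ hk
  obtain rfl : k = k' := hk
  rw [mem_confocalQuadric_iff h.axis_mono] at ht0 ht0'
  simp only [lineMap_eq] at ht0 ht0'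
  exact Prod.ext rfl (segment_unique h hc hz k ht ht' ht0 ht0')

theorem finite_visits (h : Interlaced a l) (hc : γ.HasCaustics l) (m : ℕ) {z : ℝ}
    (hz : z = 0 ∨ z ∈ Set.range a ∪ Set.range l) : (γ.visits m z).Finite :=
  Set.Finite.of_finite_image ((Set.finite_Iio m).subset (by rintro _ ⟨s, hs, rfl⟩; exact hs.1))
    (injOn_fst_visits h hc m hz)

theorem encard_visits_zero (h : Interlaced a l) (hc : γ.HasCaustics l) (m : ℕ) :
    (γ.visits m 0).encard = m := by
  rw [← (injOn_fst_visits h hc m (Or.inl rfl)).encard_image]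
  have : Prod.fst '' γ.visits m 0 = (Finset.range m : Set ℕ) := by
    ext k
    simp only [Finset.coe_range, Set.mem_Iio]
    constructor
    · rintro ⟨s, hs, rfl⟩
      exact hs.1
    · intro hk
      refine ⟨(k, 0), ⟨hk, by simp, ?_⟩, rfl⟩
      simp only [AffineMap.lineMap_apply_zero]
      exact γ.q_mem k
  rw [this, Set.encard_coe_eq_coe_finsetCard, Finset.card_range]

theorem encard_visits_ends (h : Interlaced a l) (hc : γ.HasCaustics l) {m : ℕ} (hm0 : 0 < m)
    (hm : ∀ i : ℤ, γ.q (i + m) = γ.q i) (j : Fin (n + 1)) :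
    (γ.visits m (lowerEnd a l j)).encard = (γ.visits m (upperEnd a l j)).encard := by
  rw [encard_visits h.axis_mono, encard_visits h.axis_mono, encard_path_ends h hc hm0 hm]

/-- Where the coordinate `i` vanishes, so does that component of the normal. The reflection keeps
the velocity component `i`, nonzero by `axis_ne_zero`, so the hyperplane is crossed. -/
theorem coordinate_changes_sign (h : Interlaced a l) (hc : γ.HasCaustics l) (i : Fin (n + 1))
    (k : ℤ) (h0 : γ.q k i = 0) : γ.q (k - 1) i * γ.q (k + 1) i < 0 := by
  have h1 : γ.p (k + 1) i = γ.p k i := by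
    simp [γ.p_step, reflectAt, normalVector, h0]
  have h2 : γ.q (k + 1) i = γ.len k * γ.p (k + 1) i := by
    rw [γ.q_succ]
    simp [h0]
  have h3 : γ.q (k - 1) i = -(γ.len (k - 1) * γ.p (k + 1) i) := by
    have := γ.q_succ (k - 1)
    rw [sub_add_cancel] at this
    have := congrArg (fun x => x i) this
    simp only [PiLp.add_apply, PiLp.smul_apply, smul_eq_mul, h0] at this
    rw [h1]
    linarith
  have hp : γ.p (k + 1) i ≠ 0 :=
    ((causticIdentity_q h hc k).axis_ne_zero h.injective i).resolve_left (not_not.2 h0)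
  rw [h2, h3]
  have := mul_pos (mul_pos (γ.len_pos (k - 1)) (γ.len_pos k)) (mul_self_pos.2 hp)
  linarith

/-- A segment without its final point meets `x i = 0` exactly when that coordinate vanishes at its
start or has opposite signs at its ends. -/
theorem even_visits_axis (h : Interlaced a l) (hc : γ.HasCaustics l) {m : ℕ}
    (hm : ∀ i : ℤ, γ.q (i + m) = γ.q i) (i : Fin (n + 1)) :
    ∃ r : ℕ, Even r ∧ (γ.visits m (a i)).encard = r := by
  refine ⟨_, even_card_sign_changes (y := fun k => γ.q k i) (m := m) (fun k => by rw [hm k])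
    (coordinate_changes_sign h hc i), ?_⟩
  rw [← (injOn_fst_visits h hc m (Or.inr (Or.inl ⟨i, rfl⟩))).encard_image,
    ← Set.encard_coe_eq_coe_finsetCard]
  congr 1
  ext k
  have hmem : ∀ t : ℝ, AffineMap.lineMap (γ.q k) (γ.q (k + 1)) t ∈ confocalQuadric a (a i) ↔
      γ.q k i + t * (γ.q (k + 1) i - γ.q k i) = 0 := fun t => by
    rw [mem_confocalQuadric_iff h.axis_mono, eval_confocalPoly_axis, mul_eq_zero,
      or_iff_left (eval_cofactor_axis_ne_zero h.axis_mono i), sq_eq_zero_iff]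
    simp [AffineMap.lineMap_apply, add_comm]
  simp only [Finset.coe_filter, Finset.mem_range, Set.mem_ofPred_eq]
  generalize γ.q k i = y at hmem
  generalize γ.q (k + 1) i = w at hmem
  constructor
  · rintro ⟨⟨k, t⟩, ⟨hk, ht, hv⟩, rfl⟩
    refine ⟨hk, ?_⟩
    by_contra! hcon
    have e := (hmem t).1 hv
    have hy := mul_self_pos.2 hcon.1
    have h1 := ht.1
    have h2 := ht.2
    simp only at h1 h2
    have : (1 - t) * (y * y) + t * (y * w) = 0 := by linear_combination y * e
    have h3 := mul_pos (sub_pos.2 h2) hy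
    have h4 := mul_nonneg h1 hcon.2
    linarith
  · rintro ⟨hk, hy⟩
    by_cases hy0 : y = 0
    · exact ⟨(k, 0), ⟨hk, by simp, (hmem 0).2 (by simp [hy0])⟩, rfl⟩
    · have hyw := hy.resolve_left hy0
      have hpos := mul_self_pos.2 hy0
      have hne : y - w ≠ 0 := fun e => by
        rw [← sub_eq_zero.1 e] at hyw
        linarith
      -- The extra factor `y` makes the denominator positive whatever the sign of `y`.
      have e : y / (y - w) = y * y / (y * (y - w)) := by field_simp
      have hden : y * y < y * (y - w) := by linarith
      refine ⟨(k, y / (y - w)), ⟨hk, ⟨?_, ?_⟩, (hmem _).2 ?_⟩, rfl⟩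
      · rw [e]
        exact div_nonneg hpos.le (hpos.trans hden).le
      · rw [e]
        exact (div_lt_one (hpos.trans hden)).2 hden
      · field_simp
        ring

/-- A periodic nonsingular trajectory has winding numbers. -/
theorem exists_hasWindingNumbers (h : Interlaced a l) (hc : γ.HasCaustics l) {k : ℕ}
    (hk : γ.HasPeriod k) : ∃ m : Fin (n + 1) → ℕ, γ.HasWindingNumbers l m := by
  have hu : ∀ j, (γ.visits k (upperEnd a l j)).encard = (γ.visits k (upperEnd a l j)).ncard :=
    fun j => (finite_visits h hc k (Or.inr (upperEnd_mem j))).cast_ncard_eq.symm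
  -- Visits are to be counted over `m 0` bounces, so the count for `j = 0` has to be identified with
  -- the period.
  have h0 : (γ.visits k (upperEnd a l 0)).ncard = k := by
    have := encard_visits_ends h hc hk.1.1 hk.1.2 0
    rw [lowerEnd_zero, encard_visits_zero h hc, hu] at this
    exact_mod_cast this.symm
  refine ⟨fun j => (γ.visits k (upperEnd a l j)).ncard, ?_⟩
  rw [HasWindingNumbers]
  simp only [h0]
  refine ⟨hk, _, h.isOrderedList_endList, fun j => ?_⟩
  rw [endList_even, endList_odd, encard_visits_ends h hc hk.1.1 hk.1.2, hu]
  exact ⟨rfl, rfl⟩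

end Trajectory

/-- One of the ends of the interval of an index in `E_σ` is a squared semi-axis. -/
theorem end_mem_range_axes {σ : Fin n → Fin 2}
    (hl : l ∈ causticComponent a σ) {j : Fin (n + 1)} (hj : j ∈ evenIndices σ) :
    lowerEnd a l j ∈ Set.range a ∨ upperEnd a l j ∈ Set.range a := by
  have h0 : ∀ i, σ i = 0 → l i < a i.castSucc := fun i hi => by
    have := (hl.2.2 i).2
    simp only [hi] at this
    exact this
  have h1 : ∀ i, σ i = 1 → a i.castSucc < l i := fun i hi => by
    have := (hl.2.2 i).1
    simp only [hi] at this
    exact this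
  rcases hj with ⟨i, hj, hi, hσ⟩ | ⟨i, i', hi, hi', hσ⟩ | hj
  · right
    obtain rfl : j = i.castSucc := Fin.ext (hj.trans hi.symm)
    rw [upperEnd_castSucc, min_eq_left (h1 i hσ).le]
    exact ⟨_, rfl⟩
  · by_cases hσi : σ i = 1
    · have hσi' : σ i' = 1 := by
        have : σ i' ≠ 0 := fun e => hσ (by rw [hσi, e])
        omega
      right
      obtain rfl : j = i'.castSucc := Fin.ext hi'.symm
      rw [upperEnd_castSucc, min_eq_left (h1 i' hσi').le]
      exact ⟨_, rfl⟩
    · left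
      obtain rfl : j = i.succ := Fin.ext hi.symm
      rw [lowerEnd_succ, max_eq_left (h0 i (by omega)).le]
      exact ⟨_, rfl⟩
  · right
    obtain rfl : j = Fin.last n := Fin.ext hj
    rw [upperEnd_last]
    exact ⟨_, rfl⟩

theorem interlaced_of_mem_causticComponent {σ : Fin n → Fin 2} (ha : NondegenerateAxes a)
    (hl : l ∈ causticComponent a σ) : Interlaced a l :=
  interlaced_of_mem_causticSpace ha (causticComponent_subset σ hl)

theorem Trajectory.HasWindingNumbers.even {σ : Fin n → Fin 2} (ha : NondegenerateAxes a)
    (hl : l ∈ causticComponent a σ) (hc : γ.HasCaustics l) {m : Fin (n + 1) → ℕ}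
    (hm : γ.HasWindingNumbers l m) {j : Fin (n + 1)} (hj : j ∈ evenIndices σ) : Even (m j) := by
  have h := interlaced_of_mem_causticComponent ha hl
  obtain ⟨hp, c, hco, hv⟩ := hm
  obtain rfl := h.isOrderedList_unique hco
  have hvj := hv j
  rw [endList_even, endList_odd] at hvj
  rcases end_mem_range_axes hl hj with ⟨i, hi⟩ | ⟨i, hi⟩
  · obtain ⟨r, hr, e⟩ := Trajectory.even_visits_axis h hc hp.1.2 i
    rw [hi, hvj.1] at e
    · rwa [← (by exact_mod_cast e : m j = r)] at hr
  · obtain ⟨r, hr, e⟩ := Trajectory.even_visits_axis h hc hp.1.2 i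
    rw [hi, hvj.2] at e
    rwa [← (by exact_mod_cast e : m j = r)] at hr

/-- The conditional lower bound on the period. -/
theorem kappa_le_period (hconj : WindingNumbersConjecture n) {σ : Fin n → Fin 2}
    (ha : NondegenerateAxes a) (hl : l ∈ causticComponent a σ) (hc : γ.HasCaustics l) {k : ℕ}
    (hk : γ.HasPeriod k) : kappa σ ≤ k := by
  have h := interlaced_of_mem_causticComponent ha hl
  obtain ⟨m, hm⟩ := Trajectory.exists_hasWindingNumbers h hc hk
  obtain ⟨h2, hanti⟩ := hconj a ha l (causticComponent_subset σ hl) γ hc m hm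
  exact (kappa_isLeast σ).2 ⟨m, hm.1.unique hk, h2, hanti, fun j hj => hm.even ha hl hc hj⟩

end WindingNumbers

end EllipsoidBilliard

/-! ### The values of `kappa`. -/

namespace EllipsoidBilliard

section Kappa

variable {n : ℕ} {σ : Fin n → Fin 2}

theorem le_of_strictAnti {m : Fin (n + 1) → ℕ} (h2 : 2 ≤ m (Fin.last n)) (hm : StrictAnti m)
    (j : Fin (n + 1)) : n - j + 2 ≤ m j := by
  induction j using Fin.reverseInduction with
  | last => simpa using h2
  | cast i ih =>
    have := hm i.castSucc_lt_succ
    rw [Fin.val_succ] at ih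
    rw [Fin.val_castSucc]
    omega

theorem add_le_of_strictAnti {m : Fin (n + 1) → ℕ} (hm : StrictAnti m) (j : Fin (n + 1)) :
    m j + j ≤ m 0 := by
  induction j using Fin.induction with
  | zero => simp
  | succ i ih =>
    have := hm i.castSucc_lt_succ
    rw [Fin.val_castSucc] at ih
    rw [Fin.val_succ]
    omega

theorem le_of_strictAnti_of_even {m : Fin (n + 1) → ℕ} (h2 : 2 ≤ m (Fin.last n))
    (hm : StrictAnti m) (he : ∀ j, Even (m j)) (j : Fin (n + 1)) : 2 * (n - j) + 2 ≤ m j := by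
  induction j using Fin.reverseInduction with
  | last => simpa using h2
  | cast i ih =>
    have := hm i.castSucc_lt_succ
    obtain ⟨r, hr⟩ := he i.castSucc
    rw [Fin.val_succ] at ih
    rw [Fin.val_castSucc]
    omega

theorem le_kappa (σ : Fin n → Fin 2) : n + 2 ≤ kappa σ := by
  obtain ⟨m, h0, h2, hm, -⟩ := (kappa_isLeast σ).1
  rw [← h0]
  simpa using le_of_strictAnti h2 hm 0

theorem even_of_mem_evenIndices_alternating {j : Fin (n + 1)} (hj : j ∈ evenIndices (alternating n)) :
    Even (n - j : ℕ) := by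
  have hz : ∀ i : Fin n, alternating n i = 0 ↔ Even (n - 1 - (i : ℕ)) := fun i => by
    simp [alternating]
  have ho : ∀ i : Fin n, alternating n i = 1 ↔ ¬ Even (n - 1 - (i : ℕ)) := fun i => by
    rw [← hz]
    omega
  rcases hj with ⟨i, hj, hi, hσ⟩ | ⟨i, i', hi, hi', hσ⟩ | hj
  · rw [ho] at hσ
    have := i.isLt
    grind
  · rw [Ne, Prod.mk.injEq, hz, ho] at hσ
    have := i'.isLt
    grind
  · simp [hj]

/-- The tightest sequence `n - j + 2` is already even on `E_σ`, which here contains only indices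
with `n - j` even. -/
theorem kappa_alternating : kappa (alternating n) = n + 2 := by
  refine le_antisymm ((kappa_isLeast _).2 ⟨fun j => n - j + 2, rfl, by simp, ?_, fun j hj => ?_⟩)
    (le_kappa _)
  · intro i j hij
    have := j.isLt
    have := Fin.lt_def.1 hij
    simp only
    omega
  · exact (even_of_mem_evenIndices_alternating hj).add even_two

theorem evenIndices_one (hn : 1 ≤ n) (j : Fin (n + 1)) :
    j ∈ evenIndices (fun _ : Fin n => (1 : Fin 2)) := by
  rcases Nat.eq_zero_or_pos (j : ℕ) with h0 | h0
  · exact Or.inl ⟨⟨0, hn⟩, h0, rfl, rfl⟩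
  · rcases (Nat.lt_succ_iff.1 j.isLt).lt_or_eq with h | h
    · exact Or.inr (Or.inl ⟨⟨j - 1, by omega⟩, ⟨j, h⟩, Nat.sub_add_cancel h0, rfl, by simp⟩)
    · exact Or.inr (Or.inr h)

theorem kappa_one (hn : 1 ≤ n) : kappa (fun _ : Fin n => (1 : Fin 2)) = 2 * n + 2 := by
  refine le_antisymm ((kappa_isLeast _).2 ⟨fun j => 2 * (n - j) + 2, rfl, by simp, ?_,
    fun j _ => (even_two_mul _).add even_two⟩) ?_
  · intro i j hij
    have := j.isLt
    have := Fin.lt_def.1 hij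
    simp only
    omega
  · obtain ⟨m, h0, h2, hm, he⟩ := (kappa_isLeast fun _ : Fin n => (1 : Fin 2)).1
    rw [← h0]
    simpa using le_of_strictAnti_of_even h2 hm (fun j => he j (evenIndices_one hn j)) 0

/-- Equality squeezes `m j` to `n - j + 2`, so no `j` with `n - j` odd belongs to `E_σ`. -/
theorem eq_alternating_of_kappa_eq (h : kappa σ = n + 2) : σ = alternating n := by
  obtain ⟨m, h0, h2, hm, he⟩ := (kappa_isLeast σ).1
  have hE : ∀ j : Fin (n + 1), ¬ Even (n - j : ℕ) → j ∉ evenIndices σ := fun j hj hjE => by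
    have h3 := le_of_strictAnti h2 hm j
    have h4 := add_le_of_strictAnti hm j
    have h5 := he j hjE
    rw [show m j = n - j + 2 by omega, Nat.even_add] at h5
    exact hj (h5.2 even_two)
  funext i
  have hi := i.isLt
  -- The excluded index is `i` or `i + 1`. Excluding `i` makes `σ i` the `0` of a pair `(1, 0)`, or
  -- the first entry, not `1`; excluding `i + 1` makes it the `1` of such a pair.
  by_cases hev : Even (n - 1 - (i : ℕ))
  · have hj : i.castSucc ∉ evenIndices σ := hE _ (by rw [Fin.val_castSucc]; grind)
    rw [alternating, if_pos hev]
    rcases Nat.eq_zero_or_pos (i : ℕ) with hi0 | hi0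
    · have : σ i ≠ 1 := fun e => hj (Or.inl ⟨i, hi0, hi0, e⟩)
      omega
    · by_contra hσ
      refine hj (Or.inr (Or.inl ⟨⟨i - 1, by omega⟩, i, Nat.sub_add_cancel hi0, rfl, ?_⟩))
      simp [hσ]
  · have hi' : (i : ℕ) + 1 < n := by grind
    have hj : i.succ ∉ evenIndices σ := hE _ (by rw [Fin.val_succ]; grind)
    rw [alternating, if_neg hev]
    by_contra hσ
    refine hj (Or.inr (Or.inl ⟨i, ⟨i + 1, hi'⟩, rfl, rfl, ?_⟩))
    simp [hσ]

/-- Index `0` forces the first entry to be `1`, and each later one forbids a descent from `1` to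
`0`. -/
theorem eq_one_of_forall_mem (hE : ∀ j, j ∈ evenIndices σ) : σ = fun _ => 1 := by
  have key : ∀ (k : ℕ) (hk : k < n), σ ⟨k, hk⟩ = 1 := by
    intro k
    induction k with
    | zero =>
      intro hk
      rcases hE 0 with ⟨i, -, hi, hσ⟩ | ⟨i, i', hi, -⟩ | hj
      · rwa [show i = ⟨0, hk⟩ from Fin.ext hi] at hσ
      · simp at hi
      · simp at hj
        omega
    | succ k ih =>
      intro hk
      rcases hE ⟨k + 1, by omega⟩ with ⟨i, hj, -⟩ | ⟨i, i', hi, hi', hσ⟩ | hj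
      · simp at hj
      · have e₁ : i = ⟨k, by omega⟩ := Fin.ext (by simpa using hi)
        have e₂ : i' = ⟨k + 1, hk⟩ := Fin.ext hi'
        have : σ ⟨k + 1, hk⟩ ≠ 0 := fun e => hσ (by rw [e₁, e₂, ih, e])
        omega
      · simp only at hj
        omega
  funext i
  exact key i i.isLt

theorem kappa_lt_of_notMem {j : Fin (n + 1)} (hj : j ∉ evenIndices σ) : kappa σ < 2 * n + 2 := by
  have hjn : (j : ℕ) ≠ n := fun e => hj (Or.inr (Or.inr e))
  have hjlt := j.isLt
  -- In the tightest all-even sequence, the term at the free index `j` drops by one and the earlier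
  -- terms by two.
  refine lt_of_le_of_lt ((kappa_isLeast σ).2 ⟨fun i => if j < i then 2 * (n - i) + 2 else
    if i = j then 2 * (n - i) + 1 else 2 * (n - i), rfl, ?_, ?_, fun i hi => ?_⟩) ?_
  · have : j < Fin.last n := Fin.lt_def.2 (by rw [Fin.val_last]; omega)
    simp [this]
  · intro i i' hii'
    have := i'.isLt
    simp only [Fin.lt_def, Fin.ext_iff] at hii' ⊢
    split_ifs <;> omega
  · have hij : i ≠ j := fun e => hj (e ▸ hi)
    simp only [hij, if_false]
    split_ifs
    · exact (even_two_mul _).add even_two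
    · exact even_two_mul _
  · simp only [Fin.lt_def, Fin.ext_iff, Fin.val_zero]
    split_ifs <;> omega

end Kappa

/-! ### Triaxial ellipsoids. -/

section Triaxial

theorem mem_causticComponent_two {a : Fin 3 → ℝ} {l : Fin 2 → ℝ} (h01 : l 0 < l 1)
    (hpos : 0 < l 0) (s t : Fin 2)
    (h0 : l 0 ∈ Set.Ioo (axes₀ a ⟨s, by omega⟩) (axes₀ a ⟨s + 1, by omega⟩))
    (h1 : l 1 ∈ Set.Ioo (axes₀ a ⟨t + 1, by omega⟩) (axes₀ a ⟨t + 2, by omega⟩)) :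
    l ∈ causticComponent a ![s, t] := by
  refine ⟨Fin.forall_fin_two.2 ⟨hpos, hpos.trans h01⟩, ?_, Fin.forall_fin_two.2 ⟨?_, ?_⟩⟩
  · refine Fin.strictMono_iff_lt_succ.2 fun i => ?_
    obtain rfl : i = 0 := Subsingleton.elim _ _
    exact h01
  · simpa using h0
  · have e : ((1 : Fin 2) : ℕ) + (![s, t] 1 : Fin 2) = t + 1 := add_comm 1 (t : ℕ)
    simpa only [e] using h1

theorem kappa_two (s t : Fin 2) : ∃ m : Fin 3 → ℕ, m 0 = kappa ![s, t] ∧ 2 ≤ m 2 ∧ m 2 < m 1 ∧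
    m 1 < m 0 ∧ (s = 1 → Even (m 0)) ∧ ((s, t) ≠ (1, 0) → Even (m 1)) ∧ Even (m 2) := by
  obtain ⟨m, h0, h2, hm, he⟩ := (kappa_isLeast ![s, t]).1
  refine ⟨m, h0, h2, hm (by decide), hm (by decide), fun h => he 0 ?_, fun h => he 1 ?_, he 2 ?_⟩
  · exact Or.inl ⟨0, rfl, rfl, h⟩
  · exact Or.inr (Or.inl ⟨0, 1, rfl, rfl, h⟩)
  · exact Or.inr (Or.inr rfl)

end Triaxial

end EllipsoidBilliard

theorem theorem3p1 :
    -- (i) the parity of the winding numbers (which are well defined)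
    (∀ n : ℕ, 1 ≤ n → ∀ σ : Fin n → Fin 2,
      ∀ a : Fin (n + 1) → ℝ, EllipsoidBilliard.NondegenerateAxes a →
      ∀ l ∈ EllipsoidBilliard.causticComponent a σ,
      ∀ γ : EllipsoidBilliard.Trajectory a, γ.HasCaustics l → (∃ k, γ.HasPeriod k) →
        (∃ m : Fin (n + 1) → ℕ, γ.HasWindingNumbers l m) ∧
        ∀ m : Fin (n + 1) → ℕ, γ.HasWindingNumbers l m →
          ∀ j ∈ EllipsoidBilliard.evenIndices σ, Even (m j)) ∧
    -- (ii) the conditional lower bound on the period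
    (∀ n : ℕ, 1 ≤ n → EllipsoidBilliard.WindingNumbersConjecture n → ∀ σ : Fin n → Fin 2,
      ∀ a : Fin (n + 1) → ℝ, EllipsoidBilliard.NondegenerateAxes a →
      ∀ l ∈ EllipsoidBilliard.causticComponent a σ,
      ∀ γ : EllipsoidBilliard.Trajectory a, γ.HasCaustics l →
      ∀ k : ℕ, γ.HasPeriod k → EllipsoidBilliard.kappa σ ≤ k) ∧
    -- (iii) the values of the lower bound
    (∀ n : ℕ, 1 ≤ n →
      EllipsoidBilliard.kappa (EllipsoidBilliard.alternating n) = n + 2 ∧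
      EllipsoidBilliard.kappa (fun _ : Fin n => (1 : Fin 2)) = 2 * n + 2 ∧
      ∀ σ : Fin n → Fin 2, σ ≠ (fun _ => 1) → σ ≠ EllipsoidBilliard.alternating n →
        EllipsoidBilliard.kappa (EllipsoidBilliard.alternating n) < EllipsoidBilliard.kappa σ ∧
        EllipsoidBilliard.kappa σ < EllipsoidBilliard.kappa (fun _ : Fin n => (1 : Fin 2))) ∧
    -- triaxial ellipsoids: types EH1, H1H1, EH2, H1H2
    (EllipsoidBilliard.WindingNumbersConjecture 2 →
      ∀ a : Fin 3 → ℝ, EllipsoidBilliard.NondegenerateAxes a →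
      ∀ l : Fin 2 → ℝ, l 0 < l 1 →
      ∀ γ : EllipsoidBilliard.Trajectory a, γ.HasCaustics l → ∀ k : ℕ, γ.HasPeriod k →
        (l 0 ∈ Set.Ioo 0 (a 0) → l 1 ∈ Set.Ioo (a 0) (a 1) → 5 ≤ k) ∧
        (l 0 ∈ Set.Ioo (a 0) (a 1) → l 1 ∈ Set.Ioo (a 0) (a 1) → 4 ≤ k) ∧
        (l 0 ∈ Set.Ioo 0 (a 0) → l 1 ∈ Set.Ioo (a 1) (a 2) → 5 ≤ k) ∧
        (l 0 ∈ Set.Ioo (a 0) (a 1) → l 1 ∈ Set.Ioo (a 1) (a 2) → 6 ≤ k)) := by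
  refine ⟨?_, ?_, ?_, ?_⟩
  · intro n _ σ a ha l hl γ hc ⟨k, hk⟩
    exact ⟨γ.exists_hasWindingNumbers
      (EllipsoidBilliard.interlaced_of_mem_causticComponent ha hl) hc hk,
      fun m hm j hj => hm.even ha hl hc hj⟩
  · intro n _ hconj σ a ha l hl γ hc k hk
    exact EllipsoidBilliard.kappa_le_period hconj ha hl hc hk
  · intro n hn
    refine ⟨EllipsoidBilliard.kappa_alternating, EllipsoidBilliard.kappa_one hn,
      fun σ h1 halt => ⟨?_, ?_⟩⟩
    · rw [EllipsoidBilliard.kappa_alternating]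
      exact lt_of_le_of_ne (EllipsoidBilliard.le_kappa σ)
        fun e => halt (EllipsoidBilliard.eq_alternating_of_kappa_eq e.symm)
    · rw [EllipsoidBilliard.kappa_one hn]
      obtain ⟨j, hj⟩ : ∃ j, j ∉ EllipsoidBilliard.evenIndices σ := by
        by_contra! hall
        exact h1 (EllipsoidBilliard.eq_one_of_forall_mem hall)
      exact EllipsoidBilliard.kappa_lt_of_notMem hj
  · intro hconj a ha l h01 γ hc k hk
    have hle : ∀ (s t : Fin 2), 0 < l 0 →
        l 0 ∈ Set.Ioo (EllipsoidBilliard.axes₀ a ⟨s, by omega⟩)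
          (EllipsoidBilliard.axes₀ a ⟨s + 1, by omega⟩) →
        l 1 ∈ Set.Ioo (EllipsoidBilliard.axes₀ a ⟨t + 1, by omega⟩)
          (EllipsoidBilliard.axes₀ a ⟨t + 2, by omega⟩) →
        EllipsoidBilliard.kappa ![s, t] ≤ k := fun s t hpos h0 h1 =>
      EllipsoidBilliard.kappa_le_period hconj ha
        (EllipsoidBilliard.mem_causticComponent_two h01 hpos s t h0 h1) hc hk
    -- Always `m 2 ≥ 2`. For EH1 and EH2, `m 1` is even, so `m 1 ≥ 4` and `m 0 ≥ 5`; for H1H1, `m 1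
    -- ≥ 3` and `m 0 ≥ 4`; for H1H2, `m 1 ≥ 4` and `m 0` is even, so `m 0 ≥ 6`.
    refine ⟨fun h0 h1 => ?_, fun h0 h1 => ?_, fun h0 h1 => ?_, fun h0 h1 => ?_⟩
    · have := hle 0 0 h0.1 h0 h1
      obtain ⟨m, hm, h2, h21, h10, -, he1, he2⟩ := EllipsoidBilliard.kappa_two 0 0
      have := he1 (by decide)
      grind
    · have := hle 1 0 (ha.1.trans h0.1) h0 h1
      obtain ⟨m, hm, h2, h21, h10, he0, -, he2⟩ := EllipsoidBilliard.kappa_two 1 0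
      have := he0 rfl
      grind
    · have := hle 0 1 h0.1 h0 h1
      obtain ⟨m, hm, h2, h21, h10, -, he1, he2⟩ := EllipsoidBilliard.kappa_two 0 1
      have := he1 (by decide)
      grind
    · have := hle 1 1 (ha.1.trans h0.1) h0 h1
      obtain ⟨m, hm, h2, h21, h10, he0, he1, he2⟩ := EllipsoidBilliard.kappa_two 1 1
      have := he0 rfl
      have := he1 (by decide)
      grind
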